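/- Conventions. Let $\mathcal A$ be an alphabet with $d$ letters. A generalized permutation $\pi$ is a pair of words (top row, bottom row) in which every letter of $\mathcal A$ occurs exactly twice in total. Let $H_\pi\subset\mathbb R^{\mathcal A}$ be the space of vectors $\lambda$ for which the sum of $\lambda$ along the top row equals the sum along the bottom row (letters counted with multiplicity). A linear involution $T=(\pi,\lambda)$ is given by $\pi$ and $\lambda\in H_\pi$ with positive entries. $\pi$ is irreducible if it admits suspension data: $\zeta\in\mathbb C^{\mathcal A}$ with $\mathrm{Re}\,\zeta_\alpha>0$ for all $\alpha$, with equal sums along the two rows, and such that all proper non-empty initial partial sums have positive imaginary part along the top row and negative imaginary part along the bottom row. Rauzy–Veech induction compares the lengths of the last letters of the two rows. If they differ, the letter $w$ with the larger length is the winner, the other one, $\ell$, is the loser; $\lambda_w$ is replaced by $\lambda_w-\lambda_\ell$, and the final $\ell$ is removed from its row and reinserted just after the other occurrence of $w$ if that occurrence is in the row of this final $\ell$, and just before the other occurrence of $w$ if it is in the row whose last letter is $w$ (in this last case the move is allowed only if some letter still occurs twice in what remains of the losing row). The Rauzy diagram $\mathcal D$ has as vertices the irreducible generalized permutations and as arrows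 these moves; the name of an arrow is its winner. Let $\gamma^{(n)}(T)$, $n\ge1$, be the successive arrows followed by $T$. For a path $\gamma=(\gamma(n))_{0<n\le N}$ in $\mathcal D$ starting at $\pi$, let $\Delta(\gamma)$ be the set of $T=(\pi,\lambda)$ with $\sum_\alpha\lambda_\alpha=1$ whose Rauzy path begins with $\gamma$. The volume $\mathrm{vol}(S)$ of a set $S$ of such normalized data $\lambda$ is the Lebesgue measure in $H_\pi$ of the pyramid $\{t\lambda : 0<t\le1,\ \lambda\in S\}$ (here $\dim H_\pi=d-1$, unless every letter occurs in both rows, in which case $\dim H_\pi=d$). An $s$-segment is a string of consecutive arrows in which at most $s$ names occur. Proposition. For every $d$ there exist an integer $l=l(d)$ and a constant $\eta=\eta(d)>0$ with the following property. Let $\gamma=(\gamma(n))_{0<n\le N}$ be a finite path in $\mathcal D$ whose set $\mathcal A'$ of names of arrows is distinct from $\mathcal A$, and assume that $D=\mathrm{card}\,\mathcal A'>1$. Then there is a measurable subset $\Delta'(\gamma)\subset\Delta(\gamma)$ with $$\mathrm{vol}(\Delta'(\gamma))\ \ge\ \eta\,\mathrm{vol}(\Delta(\gamma))$$ such that for every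 $T\in\Delta'(\gamma)$ there exists $M>N$, with $\gamma^{(n)}(T)$ defined for all $n\le M$, such that 1. the name of $\gamma^{(M)}(T)$ does not belong to $\mathcal A'$; 2. no more than $l$ $(D-1)$-segments are needed to cover $(\gamma^{(n)}(T))_{N\le n<M}$. -/

import Mathlib

open MeasureTheory

/-- A generalized permutation on the alphabet `A`: a pair of words (the top row and the bottom row)
in which every letter occurs exactly twice in total.  Its type is `(top.length, bot.length)`. -/
structure GenPerm (A : Type*) [DecidableEq A] where
  top : List A
  bot : List A
  two : ∀ a, (top ++ bot).count a = 2

/-- The vector space of `λ ∈ ℝ^A` such that the two rows of `π` have the same total length. -/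
def GenPerm.lengthSpace {A : Type*} [DecidableEq A] (π : GenPerm A) :
    Submodule ℝ (EuclideanSpace ℝ A) where
  carrier := {v | (π.top.map fun a => v a).sum = (π.bot.map fun a => v a).sum}
  zero_mem' := by simp
  add_mem' := by
    intro v w hv hw
    simp only [Set.mem_ofPred_eq, PiLp.add_apply, List.sum_map_add] at hv hw ⊢
    rw [hv, hw]
  smul_mem' := by
    intro c v hv
    simp only [Set.mem_ofPred_eq, PiLp.smul_apply, smul_eq_mul, List.sum_map_mul_left] at hv ⊢
    rw [hv]

/-- Suspension data over `π`: complex numbers `ζ a` with positive real part for which the two broken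
lines with successive sides `ζ` (along the top row, resp. along the bottom row) have the same end
points, the first one being strictly above and the second one strictly below the horizontal line
through the starting point, except at the two ends.  Gluing the sides of this polygon in pairs
presents the linear involution with datum `(π, Re ζ)` as a cross section of the
vertical foliation of a quadratic differential. -/
def GenPerm.IsSuspension {A : Type*} [DecidableEq A] (π : GenPerm A) (ζ : A → ℂ) : Prop :=
  (∀ a, 0 < (ζ a).re) ∧
  (∀ i, 0 < i → i < π.top.length → 0 < (((π.top.take i).map ζ).sum).im) ∧
  (∀ i, 0 < i → i < π.bot.length → (((π.bot.take i).map ζ).sum).im < 0) ∧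
  (π.top.map ζ).sum = (π.bot.map ζ).sum

/-- A generalized permutation is irreducible if it admits suspension data. -/
def GenPerm.Irreducible {A : Type*} [DecidableEq A] (π : GenPerm A) : Prop :=
  ∃ ζ : A → ℂ, π.IsSuspension ζ

/-- The Rauzy move in which the last letter `w` of the first row wins against the last
letter `l` of the second row; the last two arguments are the new rows.
* If `w` occurs in both rows, `l` is moved to the place just after the occurrence of `w` in
  the second row.
* If `w` occurs twice in the first row, `l` is moved to the first row, just before
  the first occurrence of `w`; this is defined only if some letter still occurs twice in what
  remains of the second row. -/
inductive RowMove {A : Type*} [DecidableEq A] :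
    List A → List A → A → A → List A → List A → Prop
  | simple (t b₁ b₂ : List A) (w l : A) :
      RowMove (t ++ [w]) (b₁ ++ w :: (b₂ ++ [l])) w l (t ++ [w]) (b₁ ++ w :: l :: b₂)
  | double (t₁ t₂ b : List A) (w l : A) (h : ∃ c, b.count c = 2) :
      RowMove (t₁ ++ w :: (t₂ ++ [w])) (b ++ [l]) w l (t₁ ++ l :: w :: (t₂ ++ [w])) b

/-- An arrow of the Rauzy diagram; its name is `winner`, its secondary name is `loser`. The winner
is either the last letter of the top row or the last letter of the bottom row. -/
structure RauzyArrow (A : Type*) [DecidableEq A] where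
  source : GenPerm A
  target : GenPerm A
  winner : A
  loser : A
  move : RowMove source.top source.bot winner loser target.top target.bot ∨
    RowMove source.bot source.top winner loser target.bot target.top

/-- The list of arrows `γ` is a path in the Rauzy diagram that starts at `π`. -/
def IsRauzyPath {A : Type*} [DecidableEq A] : GenPerm A → List (RauzyArrow A) → Prop
  | _, [] => True
  | π, e :: γ => e.source = π ∧ IsRauzyPath e.target γ

/-- The set of names of the arrows of `γ`. -/
def arrowNames {A : Type*} [DecidableEq A] (γ : List (RauzyArrow A)) : Finset A :=
  (γ.map RauzyArrow.winner).toFinset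

/-- The Rauzy-Veech induction, iterated from the datum `(π, lam)`, is defined for at least
`γ.length` steps, and its first `γ.length` arrows are, in this order, those of `γ`.
One step compares the lengths of the last letters of the two rows; the longer one wins, and its
length is decreased by that of the loser. -/
def RauzyFollows {A : Type*} [DecidableEq A] : GenPerm A → (A → ℝ) → List (RauzyArrow A) → Prop
  | _, _, [] => True
  | π, lam, e :: γ => e.source = π ∧ lam e.loser < lam e.winner ∧
      RauzyFollows e.target (Function.update lam e.winner (lam e.winner - lam e.loser)) γ

/-- `Δ(γ)`, for a path `γ` starting at `π`: the length data `v` of the linear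
involutions `T = (π, v)`, normalized by `∑ v = 1`, whose Rauzy path begins with `γ`. -/
def rauzySimplex {A : Type*} [Fintype A] [DecidableEq A] (π : GenPerm A)
    (γ : List (RauzyArrow A)) : Set π.lengthSpace :=
  {v | (∀ a, 0 < v.1 a) ∧ ∑ a, v.1 a = 1 ∧ RauzyFollows π (fun a => v.1 a) γ}

/-- The volume of a set `S` of normalized length data: the Lebesgue measure of the Euclidean space
`π.lengthSpace`, evaluated on the pyramid `{t • v | 0 < t ≤ 1, v ∈ S}` over `S` with apex at the
origin.  The dimension of `π.lengthSpace` is `card A - 1`, unless every letter occurs in both rows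
(the case of interval exchange maps), where it is `card A`. On subsets of
the slice `∑ v = 1` this volume is a constant times the Lebesgue measure of that slice. -/
noncomputable def rauzyVolume {A : Type*} [Fintype A] [DecidableEq A] (π : GenPerm A)
    (S : Set π.lengthSpace) : ENNReal :=
  (stdOrthonormalBasis ℝ π.lengthSpace).toBasis.addHaar
    {x | ∃ t : ℝ, 0 < t ∧ t ≤ 1 ∧ ∃ v ∈ S, x = t • v}

/-- The path `w` can be covered by at most `l` consecutive `s`-segments, an `s`-segment being a
string of consecutive arrows in which at most `s` names occur. -/
def CoveredBySegments {A : Type*} [DecidableEq A] (l s : ℕ) (w : List (RauzyArrow A)) : Prop :=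
  ∃ L : List (List (RauzyArrow A)), L.length ≤ l ∧ L.flatten = w ∧
    ∀ u ∈ L, (arrowNames u).card ≤ s

/-! Let `W` be the set of names of `γ` and `q = weight γ 1`. The old total length, 1, equals the sum
of `q a` times the new length of `a` (`sum_weight_mul_descend`). Almost every datum is generic, and
the winners of a generic datum leave every proper subset of the alphabet
(`LengthDatum.exists_exit`). It remains to bound the number of segments before the exit.

A long stay in `W` contains many blocks, each using all the names in `W`. When the winner changes,
the previous winner loses and its weight increases by that of the new winner. Hence the weights on
`W` first all reach the largest initial one, and then double every two blocks, so the lengths on `W`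
become tiny. Suppose that the forms with coefficients in `{-1, 0, 1}` supported off `W`, unless they
vanish on all balanced vectors, are at least `κ` at the datum; arrows with winner in `W` do not
change their values. Once the total length of `W` is below `κ`, no letter outside `W` loses to a
letter of `W`, and the maximal final words of the rows in the letters of `W` can only shrink. If
they do not shrink during a block, they contain both occurrences of every letter of `W`. The initial
words left over then have almost equal lengths, so by separation they have equal sums for every
balanced vector; this contradicts the opposite signs that suspension data impose. So the number of
blocks is bounded (`false_of_blocks`).

For a uniform bound `κ` must be comparable to the inverse of the total weight of `W`. An analysis of
runs of equal winners (`pathBound_of_path`, `PathBound.le`) gives a dichotomy. Either the last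
winner is blocked, and it is the only possible winner until the exit, or every weight is at most `C`
times the total weight of `W`. In the second case, pulling a bounded integral vector back along `γ`
gives a direction in the cone of `γ` on which the relevant forms are large enough
(`exists_direction`). One of `3 ^ d + 1` shears along it makes any datum well separated
(`exists_goodDirection`). These shears have determinant at least 1, so well separated data fill a
definite proportion of the simplex (`rauzyVolume_le_goodDirection`). -/

/-! ### Rows, Rauzy moves and transport of suspension data. -/

section RauzyCombinatorics

variable {A : Type*}

/-- The total length of a row. -/
def rowSum (r : List A) (v : A → ℝ) : ℝ := (r.map v).sum

@[simp] theorem rowSum_nil (v : A → ℝ) : rowSum [] v = 0 := rfl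

@[simp] theorem rowSum_cons (a : A) (r : List A) (v : A → ℝ) :
    rowSum (a :: r) v = v a + rowSum r v := by simp [rowSum]

@[simp] theorem rowSum_append (r s : List A) (v : A → ℝ) :
    rowSum (r ++ s) v = rowSum r v + rowSum s v := by simp [rowSum]

theorem rowSum_neg (r : List A) (v : A → ℝ) : rowSum r (-v) = -rowSum r v := by
  induction r with
  | nil => simp
  | cons a r ih => simp [ih]; ring

theorem im_sum_map (r : List A) (ζ : A → ℂ) :
    ((r.map ζ).sum).im = rowSum r fun a => (ζ a).im := by
  induction r with
  | nil => simp
  | cons a r ih => simp [ih]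

/-- The imaginary parts of suspension data over the pair of rows `(r₁, r₂)`. -/
def RowSuspension (r₁ r₂ : List A) (τ : A → ℝ) : Prop :=
  (∀ u v, r₁ = u ++ v → u ≠ [] → v ≠ [] → 0 < rowSum u τ) ∧
  (∀ u v, r₂ = u ++ v → u ≠ [] → v ≠ [] → rowSum u τ < 0) ∧
  rowSum r₁ τ = rowSum r₂ τ

theorem RowSuspension.symm {r₁ r₂ : List A} {τ : A → ℝ} (h : RowSuspension r₁ r₂ τ) :
    RowSuspension r₂ r₁ (-τ) := by
  refine ⟨fun u v e hu hv => ?_, fun u v e hu hv => ?_, ?_⟩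
  · rw [rowSum_neg]; linarith [h.2.1 u v e hu hv]
  · rw [rowSum_neg]; linarith [h.1 u v e hu hv]
  · rw [rowSum_neg, rowSum_neg, h.2.2]

/-- In suspension data the last letters of the two rows satisfy a strict inequality. -/
theorem RowSuspension.lt_last {t b : List A} {x y : A} {τ : A → ℝ}
    (h : RowSuspension (t ++ [x]) (b ++ [y]) τ) (hne : t ≠ [] ∨ b ≠ []) : τ x < τ y := by
  have h3 := h.2.2
  simp at h3
  have ht : 0 ≤ rowSum t τ := by
    by_cases ht : t = []
    · simp [ht]
    · exact (h.1 t [x] rfl ht (by simp)).le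
  have hb : rowSum b τ ≤ 0 := by
    by_cases hb : b = []
    · simp [hb]
    · exact (h.2.1 b [y] rfl hb (by simp)).le
  rcases hne with ht | hb
  · linarith [h.1 t [x] rfl ht (by simp)]
  · linarith [h.2.1 b [y] rfl hb (by simp)]

variable [DecidableEq A]

theorem rowSum_update_of_notMem {r : List A} {a : A} (h : a ∉ r) (v : A → ℝ) (x : ℝ) :
    rowSum r (Function.update v a x) = rowSum r v := by
  unfold rowSum
  congr 1
  refine List.map_congr_left fun b hb => Function.update_of_ne ?_ _ _
  rintro rfl
  exact h hb

/-- Each letter has only two occurrences, so the two displayed `w` are all of them; changing the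
value at `w` therefore leaves the sums over the other pieces alone. -/
theorem RowMove.normal_form {r₁ r₂ r₁' r₂' : List A} {w l : A}
    (h : RowMove r₁ r₂ w l r₁' r₂') (h2 : ∀ a, (r₁ ++ r₂).count a = 2) :
    (∃ t b₁ b₂, r₁ = t ++ [w] ∧ r₂ = b₁ ++ w :: (b₂ ++ [l]) ∧ r₁' = t ++ [w] ∧
      r₂' = b₁ ++ w :: l :: b₂ ∧ w ≠ l ∧ w ∉ t ∧ w ∉ b₁ ∧ w ∉ b₂) ∨
    (∃ t₁ t₂ b, r₁ = t₁ ++ w :: (t₂ ++ [w]) ∧ r₂ = b ++ [l] ∧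
      r₁' = t₁ ++ l :: w :: (t₂ ++ [w]) ∧ r₂' = b ∧ w ≠ l ∧ w ∉ t₁ ∧ w ∉ t₂ ∧ w ∉ b ∧
      b ≠ []) := by
  have hw := h2 w
  cases h with
  | simple t b₁ b₂ =>
    left
    by_cases hwl : w = l
    · subst hwl
      simp at hw
      omega
    · simp [Ne.symm hwl] at hw
      refine ⟨t, b₁, b₂, rfl, rfl, rfl, rfl, hwl, ?_, ?_, ?_⟩ <;>
        refine List.count_eq_zero.mp ?_ <;> omega
  | double t₁ t₂ b _ _ hc =>
    right
    have hb : r₂' ≠ [] := by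
      rintro rfl
      simp at hc
    by_cases hwl : w = l
    · subst hwl
      simp at hw
      omega
    · simp [Ne.symm hwl] at hw
      refine ⟨t₁, t₂, r₂', rfl, rfl, rfl, rfl, hwl, ?_, ?_, ?_, hb⟩ <;>
        refine List.count_eq_zero.mp ?_ <;> omega

theorem RowMove.winner_ne_loser {r₁ r₂ r₁' r₂' : List A} {w l : A}
    (h : RowMove r₁ r₂ w l r₁' r₂') (h2 : ∀ a, (r₁ ++ r₂).count a = 2) : w ≠ l := by
  rcases h.normal_form h2 with ⟨_, _, _, _, _, _, _, h, _⟩ | ⟨_, _, _, _, _, _, _, h, _⟩ <;> exact h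

theorem RowMove.getLast?_left {r₁ r₂ r₁' r₂' : List A} {w l : A}
    (h : RowMove r₁ r₂ w l r₁' r₂') : r₁.getLast? = some w := by
  cases h <;> simp [List.getLast?_append, List.getLast?_cons]

theorem RowMove.getLast?_right {r₁ r₂ r₁' r₂' : List A} {w l : A}
    (h : RowMove r₁ r₂ w l r₁' r₂') : r₂.getLast? = some l := by
  cases h <;> simp [List.getLast?_append, List.getLast?_cons]

theorem RowMove.getLast?_left' {r₁ r₂ r₁' r₂' : List A} {w l : A}
    (h : RowMove r₁ r₂ w l r₁' r₂') : r₁'.getLast? = some w := by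
  cases h <;> simp [List.getLast?_append, List.getLast?_cons]

theorem RowMove.rowSum_left {r₁ r₂ r₁' r₂' : List A} {w l : A}
    (h : RowMove r₁ r₂ w l r₁' r₂') (h2 : ∀ a, (r₁ ++ r₂).count a = 2) (v : A → ℝ) :
    rowSum r₁' (Function.update v w (v w - v l)) = rowSum r₁ v - v l := by
  rcases h.normal_form h2 with ⟨t, b₁, b₂, rfl, rfl, rfl, rfl, hwl, ht, h1, h2⟩ |
    ⟨t₁, t₂, b, rfl, rfl, rfl, rfl, hwl, ht, h1, h2, -⟩ <;>
  simp [rowSum_update_of_notMem, ht, h1, hwl.symm] <;> ring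

theorem RowMove.rowSum_right {r₁ r₂ r₁' r₂' : List A} {w l : A}
    (h : RowMove r₁ r₂ w l r₁' r₂') (h2 : ∀ a, (r₁ ++ r₂).count a = 2) (v : A → ℝ) :
    rowSum r₂' (Function.update v w (v w - v l)) = rowSum r₂ v - v l := by
  rcases h.normal_form h2 with ⟨t, b₁, b₂, rfl, rfl, rfl, rfl, hwl, ht, h1, h2⟩ |
    ⟨t₁, t₂, b, rfl, rfl, rfl, rfl, hwl, ht, h1, h2, -⟩
  · simp [rowSum_update_of_notMem, h1, h2, hwl.symm]
    ring
  · simp [rowSum_update_of_notMem, h2]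

/-- The winner gets `τ w - τ l`, so each new partial sum is an old one, except for those that end at
the moved letters. These have the right sign because `lt_last` gives `τ w < τ l`. -/
theorem RowSuspension.move {r₁ r₂ r₁' r₂' : List A} {w l : A} {τ : A → ℝ}
    (hs : RowSuspension r₁ r₂ τ)
    (h : RowMove r₁ r₂ w l r₁' r₂') (h2 : ∀ a, (r₁ ++ r₂).count a = 2) :
    RowSuspension r₁' r₂' (Function.update τ w (τ w - τ l)) := by
  refine ⟨?_, ?_, by rw [h.rowSum_left h2, h.rowSum_right h2, hs.2.2]⟩
  · rcases h.normal_form h2 with ⟨t, b₁, b₂, rfl, rfl, rfl, rfl, hwl, ht, -, -⟩ |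
      ⟨t₁, t₂, b, rfl, rfl, rfl, rfl, hwl, ht, h1, -, -⟩
    · intro u v e hu hv
      have hwu : w ∉ u := by
        obtain ⟨v', x, rfl⟩ := List.eq_nil_or_concat' v |>.resolve_left hv
        rw [← List.append_assoc] at e
        have := (List.append_inj' e rfl).1
        rw [this] at ht
        simp at ht
        exact ht.1
      rw [rowSum_update_of_notMem hwu]
      exact hs.1 u v e hu hv
    · intro u v e hu hv
      have hlast : rowSum t₁ τ + τ w < rowSum t₁ τ + τ l := by
        have := RowSuspension.lt_last (t := t₁ ++ w :: t₂) (by simpa using hs) (by simp)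
        linarith
      have hpos : 0 < rowSum t₁ τ + τ w := by
        have := hs.1 (t₁ ++ [w]) (t₂ ++ [w]) (by simp) (by simp) (by simp)
        simpa using this
      rcases List.append_eq_append_iff.mp e with ⟨a, rfl, ha⟩ | ⟨c, rfl, hc⟩
      · rcases a with _ | ⟨a₁, a⟩
        · simp only [List.append_nil] at hu ⊢
          rw [rowSum_update_of_notMem ht]
          exact hs.1 t₁ _ rfl hu (by simp)
        · simp only [List.cons_append, List.cons.injEq] at ha
          obtain ⟨rfl, ha⟩ := ha
          rcases a with _ | ⟨a₂, a⟩
          · simp [rowSum_update_of_notMem ht, hwl.symm]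
            linarith
          · simp only [List.cons_append, List.cons.injEq] at ha
            obtain ⟨rfl, ha⟩ := ha
            have hwa : w ∉ a := by
              obtain ⟨v', x, rfl⟩ := List.eq_nil_or_concat' v |>.resolve_left hv
              rw [← List.append_assoc] at ha
              have := (List.append_inj' ha rfl).1
              rw [this] at h1
              simp at h1
              exact h1.1
            have := hs.1 (t₁ ++ w :: a) v (by simp [ha]) (by simp) hv
            simp [rowSum_update_of_notMem ht, rowSum_update_of_notMem hwa, hwl.symm] at this ⊢
            linarith
      · rw [rowSum_update_of_notMem (fun h => ht (by simp [h]))]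
        exact hs.1 u (c ++ w :: (t₂ ++ [w])) (by simp) hu (by simp)
  · rcases h.normal_form h2 with ⟨t, b₁, b₂, rfl, rfl, rfl, rfl, hwl, ht, h1, hb2⟩ |
      ⟨t₁, t₂, b, rfl, rfl, rfl, rfl, hwl, ht, h1, hb, -⟩
    · intro u v e hu hv
      have hlast : τ w < τ l := by
        refine RowSuspension.lt_last (t := t) (b := b₁ ++ w :: b₂) (by simpa using hs) (by simp)
      rcases List.append_eq_append_iff.mp e with ⟨a, rfl, ha⟩ | ⟨c, rfl, hc⟩
      · rcases a with _ | ⟨a₁, a⟩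
        · simp only [List.append_nil] at hu ⊢
          rw [rowSum_update_of_notMem h1]
          exact hs.2.1 b₁ _ rfl hu (by simp)
        · simp only [List.cons_append, List.cons.injEq] at ha
          obtain ⟨rfl, ha⟩ := ha
          rcases a with _ | ⟨a₂, a⟩
          · have : rowSum b₁ τ ≤ 0 := by
              by_cases hb : b₁ = []
              · simp [hb]
              · exact (hs.2.1 b₁ _ rfl hb (by simp)).le
            simp [rowSum_update_of_notMem h1]
            linarith
          · simp only [List.cons_append, List.cons.injEq] at ha
            obtain ⟨rfl, rfl⟩ := ha
            have hwa : w ∉ a := fun h => hb2 (by simp [h])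
            have := hs.2.1 (b₁ ++ w :: a) (v ++ [l]) (by simp) (by simp) (by simp)
            simp [rowSum_update_of_notMem h1, rowSum_update_of_notMem hwa, hwl.symm] at this ⊢
            linarith
      · rw [rowSum_update_of_notMem (fun h => h1 (by simp [h]))]
        exact hs.2.1 u (c ++ w :: (b₂ ++ [l])) (by simp) hu (by simp)
    · intro u v e hu hv
      have hwu : w ∉ u := fun h => hb (by rw [e]; simp [h])
      rw [rowSum_update_of_notMem hwu]
      exact hs.2.1 u (v ++ [l]) (by simp [e]) hu (by simp)

end RauzyCombinatorics

/-! ### Single arrows: lengths, dual weights, genericity and existence. -/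

section RauzyArrows

variable {A : Type*} [DecidableEq A]

/-- Existence of the imaginary parts of suspension data. -/
def GenPerm.Suspendable (π : GenPerm A) : Prop := ∃ τ, RowSuspension π.top π.bot τ

theorem GenPerm.Irreducible.suspendable {π : GenPerm A} (h : π.Irreducible) : π.Suspendable := by
  obtain ⟨ζ, -, h1, h2, h3⟩ := h
  refine ⟨fun a => (ζ a).im, fun u v e hu hv => ?_, fun u v e hu hv => ?_, ?_⟩
  · have hu' := List.length_pos_iff.mpr hu
    have hv' := List.length_pos_iff.mpr hv
    have := h1 u.length hu' (by rw [e, List.length_append]; omega)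
    rwa [e, List.take_left, im_sum_map] at this
  · have hu' := List.length_pos_iff.mpr hu
    have hv' := List.length_pos_iff.mpr hv
    have := h2 u.length hu' (by rw [e, List.length_append]; omega)
    rwa [e, List.take_left, im_sum_map] at this
  · rw [← im_sum_map, ← im_sum_map, h3]

/-- The two rows have the same total length. -/
def GenPerm.IsBalanced (π : GenPerm A) (v : A → ℝ) : Prop := rowSum π.top v = rowSum π.bot v

theorem GenPerm.two' (π : GenPerm A) (a : A) : (π.bot ++ π.top).count a = 2 := by
  rw [List.count_append, add_comm, ← List.count_append]
  exact π.two a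

namespace RauzyArrow

/-- The effect of an arrow on the lengths. -/
def step (e : RauzyArrow A) (v : A → ℝ) : A → ℝ :=
  Function.update v e.winner (v e.winner - v e.loser)

/-- The inverse of `RauzyArrow.step`. -/
def lift (e : RauzyArrow A) (v : A → ℝ) : A → ℝ :=
  Function.update v e.winner (v e.winner + v e.loser)

/-- The transposed effect of an arrow, on weights. -/
def weigh (e : RauzyArrow A) (q : A → ℝ) : A → ℝ :=
  Function.update q e.loser (q e.loser + q e.winner)

variable (e : RauzyArrow A)

theorem winner_ne_loser : e.winner ≠ e.loser := by
  rcases e.move with h | h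
  · exact h.winner_ne_loser e.source.two
  · exact h.winner_ne_loser e.source.two'

theorem step_lift (v : A → ℝ) : e.step (e.lift v) = v := by
  simp [step, lift, e.winner_ne_loser.symm]

theorem lift_step (v : A → ℝ) : e.lift (e.step v) = v := by
  simp [step, lift, e.winner_ne_loser.symm]

theorem step_of_ne {a : A} (h : a ≠ e.winner) (v : A → ℝ) : e.step v a = v a :=
  Function.update_of_ne h _ _

theorem lift_of_ne {a : A} (h : a ≠ e.winner) (v : A → ℝ) : e.lift v a = v a :=
  Function.update_of_ne h _ _

theorem isBalanced_step_iff (v : A → ℝ) :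
    e.target.IsBalanced (e.step v) ↔ e.source.IsBalanced v := by
  unfold GenPerm.IsBalanced step
  rcases e.move with h | h
  · rw [h.rowSum_left e.source.two, h.rowSum_right e.source.two]
    exact sub_left_inj
  · rw [h.rowSum_left e.source.two', h.rowSum_right e.source.two']
    exact sub_left_inj

theorem isBalanced_lift_iff (v : A → ℝ) :
    e.source.IsBalanced (e.lift v) ↔ e.target.IsBalanced v := by
  rw [← isBalanced_step_iff, step_lift]

theorem suspendable_target (h : e.source.Suspendable) : e.target.Suspendable := by
  obtain ⟨τ, hτ⟩ := h
  rcases e.move with h | h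
  · exact ⟨_, hτ.move h e.source.two⟩
  · exact ⟨_, (hτ.symm.move h e.source.two').symm⟩

/-- A winner remains at the end of its row, hence takes part in the next comparison; if it does not
win again, it loses. All weight growth rests on this. -/
theorem winner_of_ne {e' : RauzyArrow A} (h : e'.source = e.target) (hw : e'.winner ≠ e.winner) :
    e'.loser = e.winner := by
  rcases e.move with h1 | h1 <;> rcases e'.move with h2 | h2 <;>
    have h3 := h1.getLast?_left' <;> have h4 := h2.getLast?_left <;>
    have h5 := h2.getLast?_right <;> rw [h] at h4 h5 <;> simp_all

theorem step_pos {v : A → ℝ} (hv : ∀ a, 0 < v a) (h : v e.loser < v e.winner) (a : A) :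
    0 < e.step v a := by
  by_cases ha : a = e.winner
  · subst ha; simp [step, h]
  · rw [e.step_of_ne ha]; exact hv a

theorem lift_pos {v : A → ℝ} (hv : ∀ a, 0 < v a) (a : A) : 0 < e.lift v a := by
  by_cases ha : a = e.winner
  · subst ha; simp [lift]; exact add_pos (hv _) (hv _)
  · rw [e.lift_of_ne ha]; exact hv a

theorem le_weigh {q : A → ℝ} (hq : ∀ a, 0 ≤ q a) (a : A) : q a ≤ e.weigh q a := by
  by_cases ha : a = e.loser
  · subst ha; simp [weigh, hq]
  · simp [weigh, ha]

variable [Fintype A]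

theorem sum_mul_update_left (n v : A → ℝ) (a : A) (x : ℝ) :
    ∑ b, Function.update n a x b * v b = ∑ b, n b * v b + (x - n a) * v a := by
  rw [← Finset.add_sum_erase _ _ (Finset.mem_univ a),
    ← Finset.add_sum_erase (a := a) _ (fun b => n b * v b) (Finset.mem_univ a)]
  have : ∑ b ∈ Finset.univ.erase a, Function.update n a x b * v b =
      ∑ b ∈ Finset.univ.erase a, n b * v b :=
    Finset.sum_congr rfl fun b hb => by rw [Function.update_of_ne (Finset.ne_of_mem_erase hb)]
  rw [this]
  simp
  ring

theorem sum_mul_update_right (n v : A → ℝ) (a : A) (x : ℝ) :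
    ∑ b, n b * Function.update v a x b = ∑ b, n b * v b + n a * (x - v a) := by
  simp only [mul_comm (n _)]
  rw [sum_mul_update_left]

/-- `weigh` is the inverse transpose of `step`, so the pairing of weights and lengths is invariant.
-/
theorem sum_weigh_mul_step (q v : A → ℝ) :
    ∑ a, e.weigh q a * e.step v a = ∑ a, q a * v a := by
  unfold weigh step
  rw [sum_mul_update_left, sum_mul_update_right]
  rw [Function.update_of_ne e.winner_ne_loser.symm]
  ring

end RauzyArrow

variable [Fintype A]

theorem rowSum_eq_sum (r : List A) (v : A → ℝ) : rowSum r v = ∑ a, (r.count a : ℝ) * v a := by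
  induction r with
  | nil => simp
  | cons b r ih =>
    simp only [rowSum_cons, ih, List.count_cons, Nat.cast_add, add_mul, Finset.sum_add_distrib]
    rw [add_comm]
    simp

/-- No integral linear form vanishes at `v`, unless it vanishes on all balanced vectors. -/
def GenPerm.Generic (π : GenPerm A) (v : A → ℝ) : Prop :=
  ∀ n : A → ℤ, (∃ u, π.IsBalanced u ∧ ∑ a, (n a : ℝ) * u a ≠ 0) → ∑ a, (n a : ℝ) * v a ≠ 0

/-- Composing an integral form with `step` gives an integral form, and `lift` preserves balance. -/
theorem RauzyArrow.generic_step (e : RauzyArrow A) {v : A → ℝ} (hv : e.source.Generic v) :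
    e.target.Generic (e.step v) := by
  rintro n ⟨u, hu, hne⟩
  have key : ∀ x : A → ℝ,
      ∑ a, ((Function.update n e.loser (n e.loser - n e.winner) a : ℤ) : ℝ) * x a =
        ∑ a, (n a : ℝ) * e.step x a := by
    intro x
    have : (fun a => ((Function.update n e.loser (n e.loser - n e.winner) a : ℤ) : ℝ)) =
        Function.update (fun a => (n a : ℝ)) e.loser ((n e.loser : ℝ) - n e.winner) := by
      ext a
      by_cases ha : a = e.loser
      · subst ha; simp
      · simp [ha]
    have h2 := fun a => congrFun this a
    simp only [h2]
    rw [RauzyArrow.sum_mul_update_left]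
    unfold RauzyArrow.step
    rw [RauzyArrow.sum_mul_update_right]
    ring
  rw [← key]
  refine hv _ ⟨e.lift u, (e.isBalanced_lift_iff u).mpr hu, ?_⟩
  rw [key, e.step_lift]
  exact hne

/-- The only obstruction is the side condition of a `double` move. It follows from balance: without
a double letter in `b`, the row of the longer letter `x` would be strictly longer. -/
theorem exists_rowMove {t b : List A} {x y : A} (h2 : ∀ a, ((t ++ [x]) ++ (b ++ [y])).count a = 2)
    {v : A → ℝ} (hv : ∀ a, 0 < v a) (hs : rowSum (t ++ [x]) v = rowSum (b ++ [y]) v)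
    (hxy : v y < v x) :
    ∃ r₁ r₂, RowMove (t ++ [x]) (b ++ [y]) x y r₁ r₂ ∧ ∀ a, (r₁ ++ r₂).count a = 2 := by
  have hne : y ≠ x := by rintro rfl; exact lt_irrefl _ hxy
  by_cases hb : x ∈ b
  · obtain ⟨b₁, b₂, rfl⟩ := List.append_of_mem hb
    refine ⟨t ++ [x], b₁ ++ x :: y :: b₂, by simpa using RowMove.simple t b₁ b₂ x y, fun a => ?_⟩
    have := h2 a
    simp [List.count_append, List.count_cons] at this ⊢
    omega
  · have hx := h2 x
    have hxt : x ∈ t := by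
      by_contra hxt
      simp [List.count_eq_zero_of_not_mem hb, List.count_eq_zero_of_not_mem hxt, hne] at hx
    have hc : ∃ c, b.count c = 2 := by
      by_contra! hc
      rw [rowSum_eq_sum, rowSum_eq_sum] at hs
      -- The difference of the rows has coefficient `2 - 2 * count` in terms of the count in the
      -- second row: it is 2 at `x`, at least -2 at `y`, and nonnegative elsewhere.
      have hle : ∑ a, ((if a = x then 2 * v x else 0) - (if a = y then 2 * v y else 0)) ≤
          ∑ a, (((t ++ [x]).count a : ℝ) * v a - ((b ++ [y]).count a : ℝ) * v a) := by
        refine Finset.sum_le_sum fun a _ => ?_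
        rw [← sub_mul]
        have hca := h2 a
        rw [List.count_append] at hca
        have hcr : ((t ++ [x]).count a : ℝ) = 2 - ((b ++ [y]).count a : ℝ) := by
          rw [eq_sub_iff_add_eq]; exact_mod_cast hca
        rw [hcr]
        by_cases hax : a = x
        · subst hax
          have : (b ++ [y]).count a = 0 := by
            rw [List.count_eq_zero]; simp [hb, hne.symm]
          simp [this, hne.symm]
        · by_cases hay : a = y
          · subst hay
            have : ((b ++ [a]).count a : ℝ) ≤ 2 := by exact_mod_cast (by omega)
            simp only [hax, if_false, if_true]
            nlinarith [hv a]
          · have h3 : (b ++ [y]).count a = b.count a := by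
              simp [List.count_append, Ne.symm hay]
            have h4 : (b ++ [y]).count a ≤ 1 := by
              have := hc a
              omega
            have h5 : ((b ++ [y]).count a : ℝ) ≤ 1 := by exact_mod_cast h4
            simp only [hax, hay, if_false]
            nlinarith [hv a]
      rw [Finset.sum_sub_distrib, Finset.sum_sub_distrib, hs] at hle
      simp at hle
      linarith
    obtain ⟨t₁, t₂, rfl⟩ := List.append_of_mem hxt
    refine ⟨t₁ ++ y :: x :: (t₂ ++ [x]), b, by simpa using RowMove.double t₁ t₂ b x y hc,
      fun a => ?_⟩
    have := h2 a
    simp [List.count_append, List.count_cons] at this ⊢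
    omega

theorem GenPerm.Suspendable.exists_arrow {π : GenPerm A} (hπ : π.Suspendable) {v : A → ℝ}
    (hv : ∀ a, 0 < v a) (hb : π.IsBalanced v) (hg : π.Generic v) (hA : 1 < Fintype.card A) :
    ∃ e : RauzyArrow A, e.source = π ∧ v e.loser < v e.winner := by
  have hpos : ∀ r : List A, r ≠ [] → 0 < rowSum r v := by
    intro r hr
    induction r with
    | nil => exact absurd rfl hr
    | cons a r ih =>
      by_cases h : r = []
      · simp [h, hv]
      · rw [rowSum_cons]; exact add_pos (hv a) (ih h)
  obtain ⟨a, a', haa⟩ := Fintype.one_lt_card_iff.mp hA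
  have ht : π.top ≠ [] := by
    intro ht
    by_cases hbt : π.bot = []
    · have := π.two a
      simp [ht, hbt] at this
    · have := hpos _ hbt
      rw [← hb, ht] at this
      simp at this
  have hbt : π.bot ≠ [] := by
    intro hbt
    have := hpos _ ht
    rw [hb, hbt] at this
    simp at this
  obtain ⟨t, x, htx⟩ := List.eq_nil_or_concat' π.top |>.resolve_left ht
  obtain ⟨b, y, hby⟩ := List.eq_nil_or_concat' π.bot |>.resolve_left hbt
  have h2 := π.two
  have h2' := π.two'
  rw [htx, hby] at h2 h2'
  have hne : t ≠ [] ∨ b ≠ [] := by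
    by_contra! h
    have h3 := h2 a
    have h4 := h2 a'
    simp [h.1, h.2, List.count_cons] at h3 h4
    grind
  obtain ⟨τ, hτ⟩ := hπ
  have hτ' := hτ
  rw [htx, hby] at hτ'
  have hlt := hτ'.lt_last hne
  have hxy : x ≠ y := by rintro rfl; exact lt_irrefl _ hlt
  have hform : ∀ u : A → ℝ,
      ∑ c, ((Function.update (Function.update (0 : A → ℤ) x 1) y (-1) c : ℤ) : ℝ) * u c =
        u x - u y := by
    intro u
    have : ∀ c, ((Function.update (Function.update (0 : A → ℤ) x 1) y (-1) c : ℤ) : ℝ) =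
        (if c = x then 1 else 0) - (if c = y then 1 else 0) := by
      intro c
      by_cases hcy : c = y
      · subst hcy; simp [hxy.symm]
      · by_cases hcx : c = x
        · subst hcx; simp [hxy]
        · simp [hcx, hcy]
    simp only [this, sub_mul, Finset.sum_sub_distrib]
    simp
  -- The form `v x - v y` is nonzero at the balanced vector `τ`, so genericity rules out a tie.
  have hvne : v x ≠ v y := by
    have := hg (Function.update (Function.update (0 : A → ℤ) x 1) y (-1)) ⟨τ, hτ.2.2, by
      rw [hform]; exact sub_ne_zero.mpr hlt.ne⟩
    rw [hform] at this
    exact sub_ne_zero.mp this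
  have hs : rowSum (t ++ [x]) v = rowSum (b ++ [y]) v := by rw [← htx, ← hby]; exact hb
  rcases lt_or_gt_of_ne hvne with hlt' | hlt'
  · obtain ⟨r₁, r₂, hm, hr⟩ := exists_rowMove h2' hv hs.symm hlt'
    refine ⟨⟨π, ⟨r₂, r₁, fun c => ?_⟩, y, x, Or.inr ?_⟩, rfl, hlt'⟩
    · have := hr c
      rw [List.count_append] at this ⊢
      omega
    · rw [htx, hby]; exact hm
  · obtain ⟨r₁, r₂, hm, hr⟩ := exists_rowMove h2 hv hs hlt'
    refine ⟨⟨π, ⟨r₁, r₂, hr⟩, x, y, Or.inl ?_⟩, rfl, hlt'⟩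
    rw [htx, hby]; exact hm

end RauzyArrows

/-! ### Iteration along paths. -/

section RauzyPaths

variable {A : Type*} [DecidableEq A]

/-- The lengths after following the arrows of a list. -/
def descend : List (RauzyArrow A) → (A → ℝ) → A → ℝ
  | [], v => v
  | e :: γ, v => descend γ (e.step v)

/-- The lengths before following the arrows of a list. -/
def ascend : List (RauzyArrow A) → (A → ℝ) → A → ℝ
  | [], v => v
  | e :: γ, v => e.lift (ascend γ v)

/-- The weights after following the arrows of a list. -/
def weight : List (RauzyArrow A) → (A → ℝ) → A → ℝ
  | [], q => q
  | e :: γ, q => weight γ (e.weigh q)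

/-- The last vertex of a path. -/
def endpoint : GenPerm A → List (RauzyArrow A) → GenPerm A
  | π, [] => π
  | _, e :: γ => endpoint e.target γ

theorem weight_append (γ δ : List (RauzyArrow A)) (q : A → ℝ) :
    weight (γ ++ δ) q = weight δ (weight γ q) := by
  induction γ generalizing q with
  | nil => rfl
  | cons e γ ih => exact ih _

theorem endpoint_append (π : GenPerm A) (γ δ : List (RauzyArrow A)) :
    endpoint π (γ ++ δ) = endpoint (endpoint π γ) δ := by
  induction γ generalizing π with
  | nil => rfl
  | cons e γ ih => exact ih _

theorem descend_ascend (γ : List (RauzyArrow A)) (v : A → ℝ) : descend γ (ascend γ v) = v := by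
  induction γ with
  | nil => rfl
  | cons e γ ih => simp only [descend, ascend, e.step_lift, ih]

theorem ascend_descend (γ : List (RauzyArrow A)) (v : A → ℝ) : ascend γ (descend γ v) = v := by
  induction γ generalizing v with
  | nil => rfl
  | cons e γ ih => simp only [descend, ascend, ih, e.lift_step]

theorem isRauzyPath_append {π : GenPerm A} {γ δ : List (RauzyArrow A)} :
    IsRauzyPath π (γ ++ δ) ↔ IsRauzyPath π γ ∧ IsRauzyPath (endpoint π γ) δ := by
  induction γ generalizing π with
  | nil => simp [IsRauzyPath, endpoint]
  | cons e γ ih => simp [IsRauzyPath, endpoint, ih, and_assoc]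

theorem rauzyFollows_append {π : GenPerm A} {v : A → ℝ} {γ δ : List (RauzyArrow A)} :
    RauzyFollows π v (γ ++ δ) ↔
      RauzyFollows π v γ ∧ RauzyFollows (endpoint π γ) (descend γ v) δ := by
  induction γ generalizing π v with
  | nil => simp [RauzyFollows, endpoint, descend]
  | cons e γ ih => simp [RauzyFollows, endpoint, descend, ih, and_assoc, RauzyArrow.step]

theorem RauzyFollows.isRauzyPath {π : GenPerm A} {v : A → ℝ} {γ : List (RauzyArrow A)}
    (h : RauzyFollows π v γ) : IsRauzyPath π γ := by
  induction γ generalizing π v with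
  | nil => trivial
  | cons e γ ih => exact ⟨h.1, ih h.2.2⟩

@[simp] theorem arrowNames_nil : arrowNames ([] : List (RauzyArrow A)) = ∅ := rfl

@[simp] theorem arrowNames_cons (e : RauzyArrow A) (γ : List (RauzyArrow A)) :
    arrowNames (e :: γ) = insert e.winner (arrowNames γ) := by simp [arrowNames]

@[simp] theorem arrowNames_append (γ δ : List (RauzyArrow A)) :
    arrowNames (γ ++ δ) = arrowNames γ ∪ arrowNames δ := by simp [arrowNames]

theorem mem_arrowNames {γ : List (RauzyArrow A)} {a : A} :
    a ∈ arrowNames γ ↔ ∃ e ∈ γ, e.winner = a := by simp [arrowNames]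

theorem arrowNames_flatten_subset {W : Finset A} {Bs : List (List (RauzyArrow A))}
    (h : ∀ b ∈ Bs, arrowNames b = W) : arrowNames Bs.flatten ⊆ W := by
  intro a ha
  obtain ⟨e, he, rfl⟩ := mem_arrowNames.mp ha
  obtain ⟨b, hb, heb⟩ := List.mem_flatten.mp he
  rw [← h b hb]
  exact mem_arrowNames.mpr ⟨e, heb, rfl⟩

theorem descend_of_notMem {γ : List (RauzyArrow A)} {a : A} (h : a ∉ arrowNames γ) (v : A → ℝ) :
    descend γ v a = v a := by
  induction γ generalizing v with
  | nil => rfl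
  | cons e γ ih =>
    simp only [arrowNames_cons, Finset.mem_insert, not_or] at h
    rw [descend, ih h.2, e.step_of_ne h.1]

theorem le_weight {γ : List (RauzyArrow A)} {q : A → ℝ} (hq : ∀ a, 0 ≤ q a) (a : A) :
    q a ≤ weight γ q a := by
  induction γ generalizing q with
  | nil => exact le_rfl
  | cons e γ ih => exact (e.le_weigh hq a).trans (ih fun b => (hq b).trans (e.le_weigh hq b))

theorem sum_weight_mul_descend [Fintype A] (γ : List (RauzyArrow A)) (q v : A → ℝ) :
    ∑ a, weight γ q a * descend γ v a = ∑ a, q a * v a := by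
  induction γ generalizing q v with
  | nil => rfl
  | cons e γ ih => rw [weight, descend, ih, e.sum_weigh_mul_step]

/-- `(π, v)` is a linear involution with irreducible combinatorics. -/
structure LengthDatum (π : GenPerm A) (v : A → ℝ) : Prop where
  suspendable : π.Suspendable
  pos : ∀ a, 0 < v a
  balanced : π.IsBalanced v

theorem LengthDatum.step {e : RauzyArrow A} {v : A → ℝ} (h : LengthDatum e.source v)
    (hlt : v e.loser < v e.winner) : LengthDatum e.target (e.step v) :=
  ⟨e.suspendable_target h.1, e.step_pos h.2 hlt, (e.isBalanced_step_iff v).mpr h.3⟩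

theorem LengthDatum.descend {π : GenPerm A} {v : A → ℝ} {γ : List (RauzyArrow A)}
    (h : LengthDatum π v) (hf : RauzyFollows π v γ) :
    LengthDatum (endpoint π γ) (descend γ v) := by
  induction γ generalizing π v with
  | nil => exact h
  | cons e γ ih =>
    obtain ⟨rfl, hlt, hf⟩ := hf
    exact ih (h.step hlt) hf

theorem GenPerm.Generic.descend [Fintype A] {π : GenPerm A} {v : A → ℝ} {γ : List (RauzyArrow A)}
    (h : π.Generic v) (hf : IsRauzyPath π γ) :
    (endpoint π γ).Generic (descend γ v) := by
  induction γ generalizing π v with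
  | nil => exact h
  | cons e γ ih =>
    obtain ⟨rfl, hf⟩ := hf
    exact ih (e.generic_step h) hf

theorem ascend_pos {γ : List (RauzyArrow A)} {v : A → ℝ} (hv : ∀ a, 0 < v a) (a : A) :
    0 < ascend γ v a := by
  induction γ generalizing a with
  | nil => exact hv a
  | cons e γ ih => exact e.lift_pos ih a

theorem isBalanced_ascend_iff {π : GenPerm A} {γ : List (RauzyArrow A)} (h : IsRauzyPath π γ)
    (v : A → ℝ) : π.IsBalanced (ascend γ v) ↔ (endpoint π γ).IsBalanced v := by
  induction γ generalizing π v with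
  | nil => exact Iff.rfl
  | cons e γ ih =>
    obtain ⟨rfl, h⟩ := h
    exact (e.isBalanced_lift_iff _).trans (ih h v)

theorem rauzyFollows_ascend {π : GenPerm A} {γ : List (RauzyArrow A)} (h : IsRauzyPath π γ)
    {v : A → ℝ} (hv : ∀ a, 0 < v a) : RauzyFollows π (ascend γ v) γ := by
  induction γ generalizing π v with
  | nil => trivial
  | cons e γ ih =>
    obtain ⟨rfl, h⟩ := h
    refine ⟨rfl, ?_, ?_⟩
    · have := ascend_pos (γ := γ) hv e.winner
      simp [ascend, RauzyArrow.lift, e.winner_ne_loser.symm, this]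
    · change RauzyFollows _ (e.step (e.lift _)) _
      rw [e.step_lift]
      exact ih h hv

end RauzyPaths

/-! ### Monotonicity of the final words in the letters of a subset. -/

section ClosedSuffixes

theorem rtakeWhile_append_of_forall {α : Type*} {p : α → Bool} {s : List α} (r : List α)
    (h : ∀ a ∈ s, p a) : (r ++ s).rtakeWhile p = r.rtakeWhile p ++ s := by
  simp only [List.rtakeWhile, List.reverse_append]
  rw [List.takeWhile_append_of_pos (by simpa using h)]
  simp

theorem rtakeWhile_append_of_exists {α : Type*} {p : α → Bool} {s : List α} (r : List α)
    (h : ∃ a ∈ s, ¬ p a) : (r ++ s).rtakeWhile p = s.rtakeWhile p := by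
  induction s using List.reverseRecOn with
  | nil => simp at h
  | append_singleton s a ih =>
    rw [← List.append_assoc, List.rtakeWhile_concat, List.rtakeWhile_concat]
    by_cases ha : p a
    · rw [if_pos ha, if_pos ha, ih]
      obtain ⟨b, hb, hpb⟩ := h
      rcases List.mem_append.mp hb with hb | hb
      · exact ⟨b, hb, hpb⟩
      · rw [List.mem_singleton.mp hb] at hpb
        exact absurd ha hpb
    · rw [if_neg ha, if_neg ha]

variable {A : Type*} [DecidableEq A]

/-- The letters, with multiplicity, of the maximal final subwords in the letters of `W`. -/
def finalLetters (W : Finset A) (r₁ r₂ : List A) : Multiset A :=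
  ↑(r₁.rtakeWhile (· ∈ W)) + ↑(r₂.rtakeWhile (· ∈ W))

theorem finalLetters_comm (W : Finset A) (r₁ r₂ : List A) :
    finalLetters W r₁ r₂ = finalLetters W r₂ r₁ := add_comm _ _

theorem count_finalLetters_le (W : Finset A) (r₁ r₂ : List A) (a : A) :
    (finalLetters W r₁ r₂).count a ≤ (r₁ ++ r₂).count a := by
  rw [finalLetters, Multiset.count_add, List.count_append, Multiset.coe_count, Multiset.coe_count]
  exact add_le_add ((List.rtakeWhile_suffix _ _).sublist.count_le _)
    ((List.rtakeWhile_suffix _ _).sublist.count_le _)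

theorem card_finalLetters_le (W : Finset A) (r₁ r₂ : List A) :
    (finalLetters W r₁ r₂).card ≤ r₁.length + r₂.length := by
  rw [finalLetters, Multiset.card_add, Multiset.coe_card, Multiset.coe_card]
  exact add_le_add (List.rtakeWhile_suffix _ _).sublist.length_le
    (List.rtakeWhile_suffix _ _).sublist.length_le

/-- The loser is taken from a final word and reinserted next to the other occurrence of `w`. If that
occurrence lies in a final word, the letters are only redistributed and `w` counts twice; otherwise
the loser drops out and the multiset loses an element. -/
theorem RowMove.finalLetters_le {W : Finset A} {r₁ r₂ r₁' r₂' : List A} {w l : A}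
    (h : RowMove r₁ r₂ w l r₁' r₂') (h2 : ∀ a, (r₁ ++ r₂).count a = 2) (hw : w ∈ W) (hl : l ∈ W) :
    finalLetters W r₁' r₂' ≤ finalLetters W r₁ r₂ ∧
    (finalLetters W r₁' r₂' = finalLetters W r₁ r₂ → (finalLetters W r₁ r₂).count w = 2) := by
  have hle := (count_finalLetters_le W r₁ r₂ w).trans_eq (h2 w)
  rcases h.normal_form h2 with ⟨t, b₁, b₂, rfl, rfl, rfl, rfl, -⟩ |
    ⟨t₁, t₂, b, rfl, rfl, rfl, rfl, -⟩
  · by_cases hb : ∀ a ∈ b₂, a ∈ W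
    · have e1 : (b₁ ++ w :: (b₂ ++ [l])).rtakeWhile (· ∈ W) =
          b₁.rtakeWhile (· ∈ W) ++ w :: (b₂ ++ [l]) :=
        rtakeWhile_append_of_forall _ (by grind)
      have e2 : (b₁ ++ w :: l :: b₂).rtakeWhile (· ∈ W) =
          b₁.rtakeWhile (· ∈ W) ++ w :: l :: b₂ :=
        rtakeWhile_append_of_forall _ (by grind)
      have e3 : (t ++ [w]).rtakeWhile (· ∈ W) = t.rtakeWhile (· ∈ W) ++ [w] :=
        rtakeWhile_append_of_forall _ (by simp [hw])
      refine ⟨le_of_eq ?_, fun _ => le_antisymm hle ?_⟩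
      · unfold finalLetters
        rw [e1, e2]
        congr 1
        rw [Multiset.coe_eq_coe]
        refine List.Perm.append_left _ (List.Perm.cons _ ?_)
        exact (List.perm_append_singleton l b₂).symm
      · unfold finalLetters
        rw [e1, e3]
        simp [List.count_cons]
        omega
    · have hb' : ∃ a ∈ b₂, ¬ (decide (a ∈ W)) = true := by simpa using hb
      have e1 : (b₁ ++ w :: (b₂ ++ [l])).rtakeWhile (· ∈ W) =
          b₂.rtakeWhile (· ∈ W) ++ [l] := by
        have := rtakeWhile_append_of_forall (p := (· ∈ W)) (s := [l]) (b₁ ++ w :: b₂) (by simp [hl])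
        rw [show b₁ ++ w :: (b₂ ++ [l]) = (b₁ ++ w :: b₂) ++ [l] by simp, this,
          show b₁ ++ w :: b₂ = (b₁ ++ [w]) ++ b₂ by simp, rtakeWhile_append_of_exists _ hb']
      have e2 : (b₁ ++ w :: l :: b₂).rtakeWhile (· ∈ W) = b₂.rtakeWhile (· ∈ W) := by
        rw [show b₁ ++ w :: l :: b₂ = (b₁ ++ [w, l]) ++ b₂ by simp,
          rtakeWhile_append_of_exists _ hb']
      unfold finalLetters
      rw [e1, e2]
      refine ⟨?_, fun h => ?_⟩
      · rw [← Multiset.coe_add, ← add_assoc]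
        exact Multiset.le_add_right _ _
      · have := congrArg Multiset.card h
        simp at this
  · have e1 : (r₂' ++ [l]).rtakeWhile (· ∈ W) = r₂'.rtakeWhile (· ∈ W) ++ [l] :=
      rtakeWhile_append_of_forall _ (by simp [hl])
    by_cases hb : ∀ a ∈ t₂, a ∈ W
    · have e2 : (t₁ ++ w :: (t₂ ++ [w])).rtakeWhile (· ∈ W) =
          t₁.rtakeWhile (· ∈ W) ++ w :: (t₂ ++ [w]) :=
        rtakeWhile_append_of_forall _ (by grind)
      have e3 : (t₁ ++ l :: w :: (t₂ ++ [w])).rtakeWhile (· ∈ W) =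
          t₁.rtakeWhile (· ∈ W) ++ l :: w :: (t₂ ++ [w]) :=
        rtakeWhile_append_of_forall _ (by grind)
      refine ⟨le_of_eq ?_, fun _ => le_antisymm hle ?_⟩
      · unfold finalLetters
        rw [e1, e2, e3, Multiset.coe_add, Multiset.coe_add, Multiset.coe_eq_coe,
          List.perm_iff_count]
        intro a
        simp [List.count_cons]
        omega
      · unfold finalLetters
        rw [e2]
        simp
        omega
    · have hb' : ∃ a ∈ t₂ ++ [w], ¬ (decide (a ∈ W)) = true := by
        push Not at hb
        obtain ⟨a, ha, haW⟩ := hb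
        exact ⟨a, by simp [ha], by simpa using haW⟩
      have e2 : (t₁ ++ w :: (t₂ ++ [w])).rtakeWhile (· ∈ W) = (t₂ ++ [w]).rtakeWhile (· ∈ W) := by
        rw [show t₁ ++ w :: (t₂ ++ [w]) = (t₁ ++ [w]) ++ (t₂ ++ [w]) by simp,
          rtakeWhile_append_of_exists _ hb']
      have e3 : (t₁ ++ l :: w :: (t₂ ++ [w])).rtakeWhile (· ∈ W) =
          (t₂ ++ [w]).rtakeWhile (· ∈ W) := by
        rw [show t₁ ++ l :: w :: (t₂ ++ [w]) = (t₁ ++ [l, w]) ++ (t₂ ++ [w]) by simp,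
          rtakeWhile_append_of_exists _ hb']
      unfold finalLetters
      rw [e1, e2, e3]
      refine ⟨?_, fun h => ?_⟩
      · rw [← Multiset.coe_add, ← add_assoc]
        exact Multiset.le_add_right _ _
      · have := congrArg Multiset.card h
        simp at this

theorem RauzyArrow.finalLetters_le {W : Finset A} (e : RauzyArrow A) (hw : e.winner ∈ W)
    (hl : e.loser ∈ W) :
    finalLetters W e.target.top e.target.bot ≤ finalLetters W e.source.top e.source.bot ∧
    (finalLetters W e.target.top e.target.bot = finalLetters W e.source.top e.source.bot →
      (finalLetters W e.source.top e.source.bot).count e.winner = 2) := by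
  rcases e.move with h | h
  · exact h.finalLetters_le e.source.two hw hl
  · rw [finalLetters_comm _ e.source.top, finalLetters_comm _ e.target.top]
    exact h.finalLetters_le e.source.two' hw hl

end ClosedSuffixes

/-! ### Short letters: contradiction with irreducibility. -/

section SmallLengths

variable {A : Type*} [DecidableEq A] [Fintype A]

/-- The linear forms with coefficients in `{-1, 0, 1}` supported off `W` that are smaller than `κ`
at `v` vanish on all balanced vectors. -/
def Separated (W : Finset A) (κ : ℝ) (π : GenPerm A) (v : A → ℝ) : Prop :=
  ∀ σ : A → ℤ, (∀ a, |σ a| ≤ 1) → (∀ a ∈ W, σ a = 0) → |∑ a, (σ a : ℝ) * v a| < κ →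
    ∀ u, π.IsBalanced u → ∑ a, (σ a : ℝ) * u a = 0

theorem RauzyArrow.sum_mul_step_of_eq_zero (e : RauzyArrow A) {σ : A → ℤ} (h : σ e.winner = 0)
    (u : A → ℝ) : ∑ a, (σ a : ℝ) * e.step u a = ∑ a, (σ a : ℝ) * u a := by
  unfold RauzyArrow.step
  rw [RauzyArrow.sum_mul_update_right, h]
  simp

/-- Only the length of the winner changes, and the forms concerned have coefficient zero there. -/
theorem Separated.step {W : Finset A} {κ : ℝ} {e : RauzyArrow A} {v : A → ℝ}
    (h : Separated W κ e.source v) (hw : e.winner ∈ W) : Separated W κ e.target (e.step v) := by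
  intro σ h1 h2 h3 u hu
  rw [e.sum_mul_step_of_eq_zero (h2 _ hw)] at h3
  have := h σ h1 h2 h3 (e.lift u) ((e.isBalanced_lift_iff u).mpr hu)
  rw [← e.sum_mul_step_of_eq_zero (h2 _ hw), e.step_lift] at this
  exact this

theorem Separated.descend {W : Finset A} {κ : ℝ} {π : GenPerm A} {v : A → ℝ}
    {γ : List (RauzyArrow A)} (h : Separated W κ π v) (hf : IsRauzyPath π γ)
    (hw : arrowNames γ ⊆ W) : Separated W κ (endpoint π γ) (descend γ v) := by
  induction γ generalizing π v with
  | nil => exact h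
  | cons e γ ih =>
    obtain ⟨rfl, hf⟩ := hf
    rw [arrowNames_cons, Finset.insert_subset_iff] at hw
    exact ih (h.step hw.1) hf hw.2

theorem Separated.le_of_notMem {W : Finset A} {κ : ℝ} {π : GenPerm A} {v : A → ℝ}
    (h : Separated W κ π v) (hd : LengthDatum π v) {a : A} (ha : a ∉ W) : κ ≤ v a := by
  by_contra! hlt
  have key : ∀ u : A → ℝ, ∑ b, ((Pi.single a 1 : A → ℤ) b : ℝ) * u b = u a := by
    intro u
    rw [Finset.sum_eq_single a] <;> simp +contextual
  have := h (Pi.single a 1) (fun b => by by_cases hb : b = a <;> simp [hb])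
    (fun b hb => Pi.single_eq_of_ne (by rintro rfl; exact ha hb) _)
    (by rw [key, abs_of_pos (hd.pos a)]; exact hlt) v hd.balanced
  rw [key] at this
  exact (hd.pos a).ne' this

/-- Rows that end by closed words in the letters of `W` have no suspension, if the letters of
`W` are short. -/
theorem GenPerm.Suspendable.false_of_count_eq_two {W : Finset A} {κ : ℝ} {π : GenPerm A}
    {v : A → ℝ} (hd : LengthDatum π v) (hs : Separated W κ π v) (hsmall : ∑ a ∈ W, v a < κ)
    (hW : W ≠ Finset.univ) (hc : ∀ a ∈ W, (finalLetters W π.top π.bot).count a = 2)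
    (ht : π.top.rtakeWhile (· ∈ W) ≠ []) (hb : π.bot.rtakeWhile (· ∈ W) ≠ []) : False := by
  set U := π.top.rtakeWhile (· ∈ W) with hU
  set V := π.bot.rtakeWhile (· ∈ W) with hV
  obtain ⟨X, hX⟩ : U <:+ π.top := List.rtakeWhile_suffix _ _
  obtain ⟨Y, hY⟩ : V <:+ π.bot := List.rtakeWhile_suffix _ _
  have hcount : ∀ a, X.count a + U.count a + (Y.count a + V.count a) = 2 := by
    intro a
    have := π.two a
    rwa [← hX, ← hY, List.count_append, List.count_append, List.count_append] at this
  have hUW : ∀ a ∉ W, U.count a = 0 := fun a ha => List.count_eq_zero.mpr fun h =>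
    ha (by simpa using List.mem_rtakeWhile_imp h)
  have hVW : ∀ a ∉ W, V.count a = 0 := fun a ha => List.count_eq_zero.mpr fun h =>
    ha (by simpa using List.mem_rtakeWhile_imp h)
  have hUV : ∀ a ∈ W, U.count a + V.count a = 2 := by
    intro a ha
    have := hc a ha
    rwa [finalLetters, Multiset.count_add, Multiset.coe_count, Multiset.coe_count] at this
  -- All occurrences of letters of `W` are in `U` and `V`, so the sum over `X` minus the sum over
  -- `Y` is twice a form with coefficients in `{-1, 0, 1}` supported off `W`.
  let σ : A → ℤ := fun a => if a ∈ W then 0 else (X.count a : ℤ) - 1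
  have hσ : ∀ a, (X.count a : ℝ) - Y.count a = 2 * (σ a : ℝ) := by
    intro a
    have := hcount a
    by_cases ha : a ∈ W
    · have h1 := hUV a ha
      have h2 : X.count a = 0 := by omega
      have h3 : Y.count a = 0 := by omega
      simp [σ, ha, h2, h3]
    · have h1 := hUW a ha
      have h2 := hVW a ha
      have h3 : (X.count a : ℝ) + Y.count a = 2 := by exact_mod_cast (by omega)
      simp [σ, ha]
      linarith
  have hform : ∀ u : A → ℝ, 2 * ∑ a, (σ a : ℝ) * u a = rowSum X u - rowSum Y u := by
    intro u
    rw [rowSum_eq_sum, rowSum_eq_sum, ← Finset.sum_sub_distrib, Finset.mul_sum]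
    refine Finset.sum_congr rfl fun a _ => ?_
    rw [← sub_mul, hσ, mul_assoc]
  have hbal : ∀ u, π.IsBalanced u → rowSum X u + rowSum U u = rowSum Y u + rowSum V u := by
    intro u hu
    have : rowSum π.top u = rowSum π.bot u := hu
    rwa [← hX, ← hY, rowSum_append, rowSum_append] at this
  have hbound : ∀ r : List A, (∀ a ∉ W, r.count a = 0) → (∀ a ∈ W, r.count a ≤ 2) →
      0 ≤ rowSum r v ∧ rowSum r v ≤ 2 * ∑ a ∈ W, v a := by
    intro r h0 h2
    rw [rowSum_eq_sum]
    refine ⟨Finset.sum_nonneg fun a _ => mul_nonneg (Nat.cast_nonneg _) (hd.pos a).le, ?_⟩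
    rw [← Finset.sum_subset (Finset.subset_univ W) (fun a _ ha => by rw [h0 a ha]; simp),
      Finset.mul_sum]
    refine Finset.sum_le_sum fun a ha => mul_le_mul_of_nonneg_right ?_ (hd.pos a).le
    exact_mod_cast h2 a ha
  have hUb := hbound U hUW (fun a ha => by have := hUV a ha; omega)
  have hVb := hbound V hVW (fun a ha => by have := hUV a ha; omega)
  -- By balance, twice this form is the difference of the sums over `V` and `U`, both of which lie
  -- between 0 and `2 * ∑ a ∈ W, v a < 2 * κ`.
  have hvanish := hs σ (fun a => by
      by_cases ha : a ∈ W
      · simp [σ, ha]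
      · have := hcount a
        simp only [σ, ha, if_false, abs_le]
        omega)
    (fun a ha => by simp [σ, ha]) (by
      have h1 := hform v
      have h2 := hbal v hd.balanced
      rw [abs_lt]
      constructor <;> linarith [hUb.1, hUb.2, hVb.1, hVb.2])
  obtain ⟨τ, hτ⟩ := hd.suspendable
  have h1 := hform τ
  rw [hvanish τ hτ.2.2] at h1
  have hXτ : X ≠ [] → 0 < rowSum X τ := fun h => hτ.1 X U hX.symm h ht
  have hYτ : Y ≠ [] → rowSum Y τ < 0 := fun h => hτ.2.1 Y V hY.symm h hb
  by_cases hXe : X = [] <;> by_cases hYe : Y = []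
  · apply hW
    rw [Finset.eq_univ_iff_forall]
    intro a
    by_contra ha
    have := hcount a
    rw [hUW a ha, hVW a ha, hXe, hYe] at this
    simp at this
  · have := hYτ hYe
    rw [hXe] at h1
    simp at h1
    linarith
  · have := hXτ hXe
    rw [hYe] at h1
    simp at h1
    linarith
  · linarith [hYτ hYe, hXτ hXe]

/-- The lengths of the letters of `W` are too small for the other letters to lose against them. -/
structure SmallDatum (W : Finset A) (κ : ℝ) (π : GenPerm A) (v : A → ℝ) : Prop where
  datum : LengthDatum π v
  separated : Separated W κ π v
  small : ∑ a ∈ W, v a < κ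

theorem SmallDatum.loser_mem {W : Finset A} {κ : ℝ} {e : RauzyArrow A} {v : A → ℝ}
    (h : SmallDatum W κ e.source v) (hw : e.winner ∈ W) (hlt : v e.loser < v e.winner) :
    e.loser ∈ W := by
  by_contra hl
  have h1 := h.separated.le_of_notMem h.datum hl
  have h2 := Finset.single_le_sum (fun a _ => (h.datum.pos a).le) hw
  linarith [h.small]

theorem SmallDatum.step {W : Finset A} {κ : ℝ} {e : RauzyArrow A} {v : A → ℝ}
    (h : SmallDatum W κ e.source v) (hw : e.winner ∈ W) (hlt : v e.loser < v e.winner) :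
    SmallDatum W κ e.target (e.step v) := by
  refine ⟨h.datum.step hlt, h.separated.step hw, lt_of_le_of_lt (Finset.sum_le_sum fun a _ => ?_)
    h.small⟩
  by_cases ha : a = e.winner
  · subst ha
    simp [RauzyArrow.step, (h.datum.pos _).le]
  · rw [e.step_of_ne ha]

theorem SmallDatum.descend {W : Finset A} {κ : ℝ} {π : GenPerm A} {v : A → ℝ}
    {γ : List (RauzyArrow A)} (h : SmallDatum W κ π v) (hf : RauzyFollows π v γ)
    (hw : arrowNames γ ⊆ W) :
    SmallDatum W κ (endpoint π γ) (descend γ v) ∧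
    finalLetters W (endpoint π γ).top (endpoint π γ).bot ≤ finalLetters W π.top π.bot ∧
    (finalLetters W (endpoint π γ).top (endpoint π γ).bot = finalLetters W π.top π.bot →
      ∀ a ∈ arrowNames γ, (finalLetters W π.top π.bot).count a = 2) := by
  induction γ generalizing π v with
  | nil => exact ⟨h, le_rfl, by simp⟩
  | cons e γ ih =>
    obtain ⟨rfl, hlt, hf⟩ := hf
    rw [arrowNames_cons, Finset.insert_subset_iff] at hw
    obtain ⟨i1, i2, i3⟩ := ih (h.step hw.1 hlt) hf hw.2
    obtain ⟨j1, j2⟩ := e.finalLetters_le hw.1 (h.loser_mem hw.1 hlt)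
    refine ⟨i1, i2.trans j1, fun heq => ?_⟩
    have h1 : finalLetters W e.target.top e.target.bot =
        finalLetters W e.source.top e.source.bot :=
      le_antisymm j1 (heq ▸ i2)
    rw [arrowNames_cons, Finset.forall_mem_insert]
    refine ⟨j2 h1, fun a ha => ?_⟩
    rw [← h1]
    exact i3 (heq.trans h1.symm) a ha

/-- Every block must remove at least one final letter: a block that removes none shows that each of
its winners, that is each letter of `W`, occurs twice among the final letters. -/
theorem SmallDatum.false_of_blocks {W : Finset A} {κ : ℝ} {π : GenPerm A} {v : A → ℝ}
    {Bs : List (List (RauzyArrow A))} (h : SmallDatum W κ π v)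
    (hf : RauzyFollows π v Bs.flatten) (hB : ∀ b ∈ Bs, arrowNames b = W)
    (hW : W ≠ Finset.univ) (hWne : W.Nonempty)
    (hcard : (finalLetters W π.top π.bot).card < Bs.length) : False := by
  induction Bs generalizing π v with
  | nil => simp at hcard
  | cons b Bs ih =>
    have hbW := hB b (by simp)
    rw [List.flatten_cons, rauzyFollows_append] at hf
    obtain ⟨i1, i2, i3⟩ := h.descend hf.1 hbW.subset
    by_cases heq : finalLetters W (endpoint π b).top (endpoint π b).bot =
        finalLetters W π.top π.bot
    · rcases b with _ | ⟨e, b⟩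
      · simp at hbW
        simp [← hbW] at hWne
      · obtain ⟨rfl, hlt, -⟩ := hf.1
        have hw : e.winner ∈ W := by rw [← hbW]; simp
        have hl := h.loser_mem hw hlt
        have aux : ∀ (r : List A) (a : A), r.getLast? = some a → a ∈ W →
            r.rtakeWhile (· ∈ W) ≠ [] := by
          intro r a hr ha
          obtain ⟨s, rfl⟩ := List.getLast?_eq_some_iff.mp hr
          rw [rtakeWhile_append_of_forall _ (by simpa using ha)]
          simp
        refine GenPerm.Suspendable.false_of_count_eq_two h.datum h.separated h.small hW
          (fun a ha => i3 heq a (hbW ▸ ha)) ?_ ?_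
        · rcases e.move with hm | hm
          · exact aux _ _ hm.getLast?_left hw
          · exact aux _ _ hm.getLast?_right hl
        · rcases e.move with hm | hm
          · exact aux _ _ hm.getLast?_right hl
          · exact aux _ _ hm.getLast?_left hw
    · refine ih i1 hf.2 (fun b' hb' => hB b' (by simp [hb'])) ?_
      have := Multiset.card_lt_card (lt_of_le_of_ne i2 heq)
      simp at hcard
      omega

end SmallLengths

/-! ### Growth of weights along blocks that use every name. -/

section WeightGrowth

variable {A : Type*} [DecidableEq A]

/-- Consider the first time the winner passes from outside `P` into `P`: the previous winner,
outside `P`, loses to a letter of weight at least `θ`. -/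
theorem exists_weight_gain {P : Finset A} {θ : ℝ} {e : RauzyArrow A} {δ : List (RauzyArrow A)}
    {q : A → ℝ} (hδ : IsRauzyPath e.target δ) (hq : ∀ a, 0 ≤ q a) (he : e.winner ∉ P)
    (hP : ∃ a ∈ P, a ∈ arrowNames δ) (hθ : ∀ a ∈ P, θ ≤ q a) :
    ∃ y ∈ arrowNames (e :: δ), y ∉ P ∧ q y + θ ≤ weight δ q y := by
  induction δ generalizing e q with
  | nil => simp at hP
  | cons e' δ ih =>
    obtain ⟨hs, hδ⟩ := hδ
    have hq' : ∀ a, 0 ≤ e'.weigh q a := fun a => (hq a).trans (e'.le_weigh hq a)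
    by_cases he' : e'.winner ∈ P
    · have hl : e'.loser = e.winner := e.winner_of_ne hs (by rintro h; exact he (h ▸ he'))
      refine ⟨e.winner, by simp, he, ?_⟩
      refine le_trans ?_ (le_weight hq' e.winner)
      rw [← hl]
      simp [RauzyArrow.weigh, hθ _ he']
    · obtain ⟨a, haP, ha⟩ := hP
      rw [arrowNames_cons, Finset.mem_insert] at ha
      obtain ⟨y, hy, hyP, hle⟩ := ih (e := e') hδ hq' he'
        ⟨a, haP, ha.resolve_left (by rintro rfl; exact he' haP)⟩
        (fun b hb => (hθ b hb).trans (e'.le_weigh hq b))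
      refine ⟨y, by simp only [arrowNames_cons, Finset.mem_insert] at hy ⊢; tauto, hyP, ?_⟩
      exact le_trans (by linarith [e'.le_weigh hq y]) hle

/-- The first block provides a winner outside `P`, the second one a later winner in `P`. -/
theorem exists_weight_gain_of_blocks {W P : Finset A} {θ : ℝ} {π : GenPerm A}
    {b₁ b₂ : List (RauzyArrow A)} {q : A → ℝ} (hp : IsRauzyPath π (b₁ ++ b₂))
    (h1 : arrowNames b₁ = W) (h2 : arrowNames b₂ = W) (hq : ∀ a, 0 ≤ q a)
    (hPW : P ⊂ W) (hP : P.Nonempty) (hθ : ∀ a ∈ P, θ ≤ q a) :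
    ∃ y ∈ W, y ∉ P ∧ q y + θ ≤ weight (b₁ ++ b₂) q y := by
  obtain ⟨x, hxW, hxP⟩ := Finset.exists_of_ssubset hPW
  rw [← h1] at hxW
  obtain ⟨e, he, rfl⟩ := mem_arrowNames.mp hxW
  obtain ⟨u, v, rfl⟩ := List.append_of_mem he
  rw [show u ++ e :: v ++ b₂ = (u ++ [e]) ++ (v ++ b₂) by simp, isRauzyPath_append,
    endpoint_append] at hp
  obtain ⟨z, hz⟩ := hP
  have hq' : ∀ a, q a ≤ weight (u ++ [e]) q a := fun a => le_weight hq a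
  obtain ⟨y, hy, hyP, hle⟩ := exists_weight_gain (e := e) hp.2 (fun a => (hq a).trans (hq' a)) hxP
    ⟨z, hz, by rw [arrowNames_append, h2]; exact Finset.mem_union_right _ (hPW.1 hz)⟩
    (fun a ha => (hθ a ha).trans (hq' a))
  refine ⟨y, ?_, hyP, ?_⟩
  · rw [← Finset.union_self W]
    nth_rewrite 1 [← h1]
    rw [← h2]
    simp only [arrowNames_append, arrowNames_cons, Finset.mem_union, Finset.mem_insert] at hy ⊢
    tauto
  · rw [show u ++ e :: v ++ b₂ = (u ++ [e]) ++ (v ++ b₂) by simp, weight_append]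
    linarith [hq' y]

/-- With `P` the set of letters of weight at least `θ`, every pair of blocks brings a new letter
into `P`. -/
theorem le_weight_of_blocks {W : Finset A} {θ : ℝ} (n : ℕ) {π : GenPerm A}
    {Bs : List (List (RauzyArrow A))} {q : A → ℝ} (hp : IsRauzyPath π Bs.flatten)
    (hB : ∀ b ∈ Bs, arrowNames b = W) (hq : ∀ a, 0 ≤ q a) (hn : 2 * n ≤ Bs.length)
    (hW : (W.filter fun a => q a < θ).card ≤ n) (hne : ∃ a ∈ W, θ ≤ q a) :
    ∀ a ∈ W, θ ≤ weight Bs.flatten q a := by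
  induction n generalizing π Bs q with
  | zero =>
    intro a ha
    refine le_trans ?_ (le_weight hq a)
    by_contra! h
    have := Finset.card_eq_zero.mp (Nat.le_zero.mp hW)
    have h2 : a ∈ W.filter fun a => q a < θ := Finset.mem_filter.mpr ⟨ha, h⟩
    rw [this] at h2
    simp at h2
  | succ n ih =>
    match Bs with
    | [] => simp at hn
    | [_] => simp at hn; omega
    | b₁ :: b₂ :: Bs =>
      rw [List.flatten_cons, List.flatten_cons, ← List.append_assoc] at hp ⊢
      have hp' := isRauzyPath_append.mp hp
      have hq' : ∀ a, q a ≤ weight (b₁ ++ b₂) q a := fun a => le_weight hq a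
      rw [weight_append]
      obtain ⟨c, hcW, hc⟩ := hne
      refine ih hp'.2 (fun b hb => hB b (by simp [hb])) (fun a => (hq a).trans (hq' a))
        (by simp at hn; omega) ?_ ⟨c, hcW, hc.trans (hq' c)⟩
      have hsub : (W.filter fun a => weight (b₁ ++ b₂) q a < θ) ⊆ W.filter fun a => q a < θ :=
        Finset.monotone_filter_right _ fun a _ h => lt_of_le_of_lt (hq' a) h
      by_cases hP : (W.filter fun a => θ ≤ q a) = W
      · have : (W.filter fun a => weight (b₁ ++ b₂) q a < θ) = ∅ := by
          rw [Finset.filter_eq_empty_iff]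
          intro a ha
          exact not_lt.mpr ((Finset.filter_eq_self.mp hP a ha).trans (hq' a))
        rw [this]
        simp
      · obtain ⟨y, hyW, hyP, hy⟩ := exists_weight_gain_of_blocks (P := W.filter fun a => θ ≤ q a)
          (θ := θ) hp'.1 (hB b₁ (by simp)) (hB b₂ (by simp)) hq
          (lt_of_le_of_ne (Finset.filter_subset _ _) hP) ⟨c, by simp [hcW, hc]⟩
          (fun a ha => (Finset.mem_filter.mp ha).2)
        have hlt : q y < θ := by
          by_contra! h
          exact hyP (Finset.mem_filter.mpr ⟨hyW, h⟩)
        have : (W.filter fun a => weight (b₁ ++ b₂) q a < θ) ⊂ W.filter fun a => q a < θ := by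
          refine Finset.ssubset_iff_of_subset hsub |>.mpr ⟨y, by simp [hyW, hlt], ?_⟩
          simp only [Finset.mem_filter, not_and, not_lt]
          intro _
          linarith [hq y]
        have := Finset.card_lt_card this
        omega

/-- With `P` equal to `W` minus one letter, that letter is the one that gains `θ`; so every pair of
blocks doubles the common lower bound. -/
theorem two_pow_mul_le_weight_of_blocks {W : Finset A} {θ : ℝ} (k : ℕ) {π : GenPerm A}
    {Bs : List (List (RauzyArrow A))} {q : A → ℝ} (hp : IsRauzyPath π Bs.flatten)
    (hB : ∀ b ∈ Bs, arrowNames b = W) (hq : ∀ a, 0 ≤ q a) (hk : 2 * k ≤ Bs.length)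
    (hW : 1 < W.card) (hθ : ∀ a ∈ W, θ ≤ q a) :
    ∀ a ∈ W, 2 ^ k * θ ≤ weight Bs.flatten q a := by
  induction k generalizing π Bs q θ with
  | zero => exact fun a ha => by simpa using (hθ a ha).trans (le_weight hq a)
  | succ k ih =>
    match Bs with
    | [] => simp at hk
    | [_] => simp at hk; omega
    | b₁ :: b₂ :: Bs =>
      rw [List.flatten_cons, List.flatten_cons, ← List.append_assoc] at hp ⊢
      have hp' := isRauzyPath_append.mp hp
      have hq' : ∀ a, q a ≤ weight (b₁ ++ b₂) q a := fun a => le_weight hq a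
      rw [weight_append, pow_succ, mul_assoc]
      refine ih hp'.2 (fun b hb => hB b (by simp [hb])) (fun a => (hq a).trans (hq' a))
        (by simp at hk; omega) fun a ha => ?_
      obtain ⟨y, hyW, hyP, hy⟩ := exists_weight_gain_of_blocks (P := W.erase a)
          (θ := θ) hp'.1 (hB b₁ (by simp)) (hB b₂ (by simp)) hq (Finset.erase_ssubset ha)
          (by rw [← Finset.card_pos, Finset.card_erase_of_mem ha]; omega)
          (fun a ha => hθ a (Finset.mem_of_mem_erase ha))
      have : y = a := by
        by_contra h
        exact hyP (Finset.mem_erase.mpr ⟨h, hyW⟩)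
      subst this
      linarith [hθ y ha]

variable [Fintype A]

theorem GenPerm.length_add_length (π : GenPerm A) :
    π.top.length + π.bot.length = 2 * Fintype.card A := by
  have h : ∀ r : List A, (r.length : ℝ) = rowSum r 1 := by
    intro r
    induction r with
    | nil => simp
    | cons a r ih => simp [ih, add_comm]
  have : ((π.top ++ π.bot).length : ℝ) = 2 * Fintype.card A := by
    rw [h, rowSum_eq_sum]
    simp [π.two, mul_comm]
  rw [List.length_append] at this
  exact_mod_cast this

theorem false_of_blocks {W : Finset A} {κ θ : ℝ} {k : ℕ} {π : GenPerm A} {v q : A → ℝ}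
    {Bs : List (List (RauzyArrow A))} (hd : LengthDatum π v) (hs : Separated W κ π v)
    (hq : ∀ a, 0 ≤ q a) (hqv : ∑ a, q a * v a ≤ 1) (hWu : W ≠ Finset.univ) (hW : 1 < W.card)
    (hθ : ∃ a ∈ W, θ ≤ q a) (hθ0 : 0 < θ) (hκ : 1 < 2 ^ k * θ * κ)
    (hf : RauzyFollows π v Bs.flatten) (hB : ∀ b ∈ Bs, arrowNames b = W)
    (hl : 2 * W.card + 2 * k + 2 * Fintype.card A < Bs.length) : False := by
  -- `B₁` spreads the weight `θ` to all of `W`, `B₂` multiplies it by `2 ^ k`, which makes `W`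
  -- short, and `B₃` has more blocks than there can be final letters.
  obtain ⟨B₁, B', rfl, h1⟩ : ∃ B₁ B', Bs = B₁ ++ B' ∧ B₁.length = 2 * W.card :=
    ⟨Bs.take (2 * W.card), Bs.drop (2 * W.card), (List.take_append_drop _ _).symm, by simp; omega⟩
  obtain ⟨B₂, B₃, rfl, h2⟩ : ∃ B₂ B₃, B' = B₂ ++ B₃ ∧ B₂.length = 2 * k :=
    ⟨B'.take (2 * k), B'.drop (2 * k), (List.take_append_drop _ _).symm, by simp at hl ⊢; omega⟩
  rw [List.flatten_append, rauzyFollows_append, List.flatten_append, rauzyFollows_append] at hf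
  obtain ⟨f1, f2, f3⟩ := hf
  simp only [List.mem_append] at hB
  have hB1 : ∀ b ∈ B₁, arrowNames b = W := fun b hb => hB b (Or.inl hb)
  have hB2 : ∀ b ∈ B₂, arrowNames b = W := fun b hb => hB b (Or.inr (Or.inl hb))
  have hB3 : ∀ b ∈ B₃, arrowNames b = W := fun b hb => hB b (Or.inr (Or.inr hb))
  have g1 := le_weight_of_blocks W.card f1.isRauzyPath hB1 hq h1.ge
    (Finset.card_filter_le _ _) hθ
  have hq1 : ∀ a, 0 ≤ weight B₁.flatten q a := fun a => (hq a).trans (le_weight hq a)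
  have g2 := two_pow_mul_le_weight_of_blocks k f2.isRauzyPath hB2 hq1 h2.ge hW g1
  have hd2 := (hd.descend f1).descend f2
  have hs2 := (hs.descend f1.isRauzyPath (arrowNames_flatten_subset hB1)).descend f2.isRauzyPath
    (arrowNames_flatten_subset hB2)
  have hsum := (sum_weight_mul_descend B₂.flatten (weight B₁.flatten q)
    (descend B₁.flatten v)).trans (sum_weight_mul_descend B₁.flatten q v)
  set q' := weight B₂.flatten (weight B₁.flatten q) with hq'
  set v' := descend B₂.flatten (descend B₁.flatten v)
  have hq2 : ∀ a, 0 ≤ q' a := fun a => (hq1 a).trans (le_weight hq1 a)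
  have hsm : SmallDatum W κ (endpoint (endpoint π B₁.flatten) B₂.flatten) v' := by
    refine ⟨hd2, hs2, ?_⟩
    have h3 : 2 ^ k * θ * ∑ a ∈ W, v' a ≤ 1 := by
      rw [Finset.mul_sum]
      calc ∑ a ∈ W, 2 ^ k * θ * v' a ≤ ∑ a ∈ W, q' a * v' a :=
            Finset.sum_le_sum fun a ha => mul_le_mul_of_nonneg_right (g2 a ha) (hd2.pos a).le
        _ ≤ ∑ a, q' a * v' a := Finset.sum_le_univ_sum_of_nonneg fun a =>
            mul_nonneg (hq2 a) (hd2.pos a).le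
        _ ≤ 1 := hsum ▸ hqv
    by_contra! h4
    have : 2 ^ k * θ * κ ≤ 2 ^ k * θ * ∑ a ∈ W, v' a := by gcongr
    linarith
  refine hsm.false_of_blocks f3 hB3 hWu (Finset.card_pos.mp (by omega))
    (lt_of_le_of_lt (card_finalLetters_le _ _ _) ?_)
  rw [GenPerm.length_add_length]
  simp at hl
  omega

end WeightGrowth

/-! ### Segments versus blocks, and exit from proper subsets. -/

section Exit

variable {A : Type*} [DecidableEq A]

theorem exists_prefix_arrowNames_eq {W : Finset A} (hW : W.Nonempty) {w : List (RauzyArrow A)}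
    (hw : arrowNames w = W) : ∃ u e r, w = u ++ e :: r ∧ arrowNames u ⊂ W ∧
      arrowNames (u ++ [e]) = W := by
  induction w using List.reverseRecOn with
  | nil => simp [← hw] at hW
  | append_singleton w e ih =>
    by_cases h : arrowNames w = W
    · obtain ⟨u, e', r, rfl, h1, h2⟩ := ih h
      exact ⟨u, e', r ++ [e], by simp, h1, h2⟩
    · refine ⟨w, e, [], rfl, lt_of_le_of_ne ?_ h, hw⟩
      rw [← hw, arrowNames_append]
      exact Finset.subset_union_left

/-- Cut greedily each time all names have appeared. Such a block consists of a segment missing a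
name and one further arrow, whence the factor 2. -/
theorem coveredBySegments_or_exists_blocks {W : Finset A} (hW : 1 < W.card) (l : ℕ)
    {w : List (RauzyArrow A)} (hw : arrowNames w ⊆ W) :
    CoveredBySegments (2 * l) (W.card - 1) w ∨
    ∃ (Bs : List (List (RauzyArrow A))) (r : List (RauzyArrow A)),
      Bs.length = l ∧ w = Bs.flatten ++ r ∧ ∀ b ∈ Bs, arrowNames b = W := by
  induction l generalizing w with
  | zero => exact Or.inr ⟨[], w, rfl, by simp, by simp⟩
  | succ l ih =>
    by_cases h : arrowNames w = W
    · obtain ⟨u, e, r, rfl, h1, h2⟩ := exists_prefix_arrowNames_eq (Finset.card_pos.mp (by omega)) h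
      have hr : arrowNames r ⊆ W := by
        refine subset_trans ?_ hw
        rw [show u ++ e :: r = (u ++ [e]) ++ r by simp, arrowNames_append (u ++ [e])]
        exact Finset.subset_union_right
      rcases ih hr with ⟨L, hL, rfl, hL'⟩ | ⟨Bs, r', rfl, rfl, hBs⟩
      · refine Or.inl ⟨u :: [e] :: L, by simp; omega, by simp, ?_⟩
        simp only [List.forall_mem_cons]
        refine ⟨?_, ?_, hL'⟩
        · have := Finset.card_lt_card h1
          omega
        · simp; omega
      · exact Or.inr ⟨(u ++ [e]) :: Bs, r', by simp, by simp, List.forall_mem_cons.mpr ⟨h2, hBs⟩⟩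
    · left
      have := Finset.card_lt_card (lt_of_le_of_ne hw h)
      exact ⟨[w], by simp; omega, by simp, by simp; omega⟩

theorem descend_le_of_arrowNames_subset_singleton {b : A} {κ : ℝ} {π : GenPerm A} {v : A → ℝ}
    {γ : List (RauzyArrow A)} (hf : RauzyFollows π v γ) (hγ : arrowNames γ ⊆ {b})
    (hκ : ∀ a, a ≠ b → κ ≤ v a) : descend γ v b + γ.length * κ ≤ v b := by
  induction γ generalizing π v with
  | nil => simp [descend]
  | cons e γ ih =>
    obtain ⟨-, -, hf⟩ := hf
    rw [arrowNames_cons, Finset.insert_subset_iff, Finset.mem_singleton] at hγ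
    have := ih (v := e.step v) hf hγ.2 (fun a ha => by
      rw [e.step_of_ne (hγ.1 ▸ ha)]; exact hκ a ha)
    have h1 := hκ e.loser (fun h => e.winner_ne_loser (hγ.1.trans h.symm))
    have h2 : e.step v b = v b - v e.loser := by rw [← hγ.1]; simp [RauzyArrow.step]
    rw [h2] at this
    simp only [descend, List.length_cons, Nat.cast_add, Nat.cast_one]
    linarith

variable [Fintype A]

/-- Only finitely many forms are involved; `κ` is a lower bound for their nonzero absolute values at
`v`, and genericity makes the others vanish on all balanced vectors. -/
theorem exists_separated (W : Finset A) {π : GenPerm A} {v : A → ℝ} (hg : π.Generic v) :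
    ∃ κ, 0 < κ ∧ Separated W κ π v := by
  have key : ∀ s : Finset (A → ℤ), ∃ κ : ℝ, 0 < κ ∧ ∀ σ ∈ s, ∑ a, (σ a : ℝ) * v a ≠ 0 →
      κ ≤ |∑ a, (σ a : ℝ) * v a| := by
    intro s
    induction s using Finset.induction_on with
    | empty => exact ⟨1, one_pos, by simp⟩
    | insert σ s _ ih =>
      obtain ⟨κ, h0, h⟩ := ih
      by_cases hσ : ∑ a, (σ a : ℝ) * v a = 0
      · refine ⟨κ, h0, ?_⟩
        rw [Finset.forall_mem_insert]
        exact ⟨fun h => absurd hσ h, h⟩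
      · refine ⟨min κ |∑ a, (σ a : ℝ) * v a|, lt_min h0 (abs_pos.mpr hσ), ?_⟩
        rw [Finset.forall_mem_insert]
        exact ⟨fun _ => min_le_right _ _, fun σ' h' hne => (min_le_left _ _).trans (h σ' h' hne)⟩
  obtain ⟨κ, h0, h⟩ := key (Finset.Icc (-1) 1)
  refine ⟨κ, h0, fun σ h1 _ h3 u hu => ?_⟩
  by_contra hne
  have hmem : σ ∈ Finset.Icc (-1 : A → ℤ) 1 := by
    rw [Finset.mem_Icc]
    exact ⟨fun a => (abs_le.mp (h1 a)).1, fun a => (abs_le.mp (h1 a)).2⟩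
  exact absurd h3 (not_lt.mpr (h σ hmem (hg σ ⟨u, hu, hne⟩)))

/-- A generic linear involution has infinitely many arrows, and its winners are not confined to a
proper subset of the alphabet. -/
theorem LengthDatum.exists_exit (hA : 1 < Fintype.card A) (W : Finset A) (hW : W ≠ Finset.univ)
    {π : GenPerm A} {v : A → ℝ} (hd : LengthDatum π v) (hg : π.Generic v) :
    ∃ δ e, RauzyFollows π v (δ ++ [e]) ∧ arrowNames δ ⊆ W ∧ e.winner ∉ W := by
  induction W using Finset.strongInduction generalizing π v with
  | H W IH =>
    by_cases hWe : W = ∅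
    · obtain ⟨e, rfl, hlt⟩ := hd.1.exists_arrow hd.2 hd.3 hg hA
      exact ⟨[], e, ⟨rfl, hlt, trivial⟩, by simp, by simp [hWe]⟩
    by_contra hex
    replace hex : ∀ δ e, RauzyFollows π v (δ ++ [e]) → arrowNames δ ⊆ W → e.winner ∈ W := by
      intro δ e h1 h2
      by_contra h3
      exact hex ⟨δ, e, h1, h2, h3⟩
    -- If the path never leaves `W`, a piece `b` can be prolonged until it has all names in `W`: its
    -- names form a proper subset, which is left by the induction hypothesis, and each exit adds a
    -- name in `W`.
    have block : ∀ n : ℕ, ∀ u b, RauzyFollows π v (u ++ b) → arrowNames u ⊆ W →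
        arrowNames b ⊆ W → (W \ arrowNames b).card ≤ n →
        ∃ b', RauzyFollows π v (u ++ b') ∧ arrowNames b' = W := by
      intro n
      induction n with
      | zero =>
        intro u b hf hu hb hn
        refine ⟨b, hf, subset_antisymm hb ?_⟩
        rw [← Finset.sdiff_eq_empty_iff_subset]
        exact Finset.card_eq_zero.mp (Nat.le_zero.mp hn)
      | succ n ih =>
        intro u b hf hu hb hn
        by_cases hbW : arrowNames b = W
        · exact ⟨b, hf, hbW⟩
        · have hss : arrowNames b ⊂ W := lt_of_le_of_ne hb hbW
          obtain ⟨δ, e, h1, h2, h3⟩ := IH _ hss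
            (fun h => by rw [h] at hss; exact hss.2 (Finset.subset_univ _))
            (hd.descend hf) (hg.descend hf.isRauzyPath)
          have hf' : RauzyFollows π v ((u ++ b) ++ (δ ++ [e])) := rauzyFollows_append.mpr ⟨hf, h1⟩
          have heW : e.winner ∈ W := by
            refine hex (u ++ b ++ δ) e (by simpa using hf') ?_
            rw [arrowNames_append, arrowNames_append]
            exact Finset.union_subset (Finset.union_subset hu hb) (h2.trans hb)
          refine ih u (b ++ (δ ++ [e])) (by simpa using hf') hu ?_ ?_
          · rw [arrowNames_append, arrowNames_append]
            refine Finset.union_subset hb (Finset.union_subset (h2.trans hb) ?_)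
            simpa using heW
          · have : (W \ arrowNames (b ++ (δ ++ [e]))) ⊂ W \ arrowNames b := by
              refine (Finset.ssubset_iff_of_subset ?_).mpr ⟨e.winner, by simp [heW, h3], by simp⟩
              refine Finset.sdiff_subset_sdiff le_rfl ?_
              rw [arrowNames_append]
              exact Finset.subset_union_left
            have := Finset.card_lt_card this
            omega
    have blocks : ∀ R : ℕ, ∃ Bs : List (List (RauzyArrow A)), Bs.length = R ∧
        RauzyFollows π v Bs.flatten ∧ ∀ b ∈ Bs, arrowNames b = W := by
      intro R
      induction R with
      | zero => exact ⟨[], rfl, trivial, by simp⟩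
      | succ R ih =>
        obtain ⟨Bs, rfl, hf, hB⟩ := ih
        obtain ⟨b, hb, hbW⟩ := block _ Bs.flatten [] (by simpa using hf)
          (arrowNames_flatten_subset hB) (by simp) le_rfl
        refine ⟨Bs ++ [b], by simp, by simpa using hb, ?_⟩
        intro c hc
        rcases List.mem_append.mp hc with hc | hc
        · exact hB c hc
        · rw [List.mem_singleton.mp hc, hbW]
    have hWne : W.Nonempty := Finset.nonempty_iff_ne_empty.mpr hWe
    obtain ⟨κ, hκ0, hκ⟩ := exists_separated W hg
    -- With two or more letters, weight growth from a constant weight bounds the number of blocks.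
    -- With one letter, all losers have length at least `κ`, so the winner is used up in finitely
    -- many steps.
    rcases lt_or_eq_of_le (Nat.succ_le_of_lt hWne.card_pos) with hcard | hcard
    · have hsum : 0 < ∑ a, v a :=
        Finset.sum_pos (fun a _ => hd.pos a) (hWne.mono (Finset.subset_univ _))
      have hθ : 0 < (∑ a, v a)⁻¹ := inv_pos.mpr hsum
      obtain ⟨k, hk⟩ := pow_unbounded_of_one_lt ((∑ a, v a)⁻¹ * κ)⁻¹ (one_lt_two (α := ℝ))
      obtain ⟨Bs, hl, hf, hB⟩ := blocks (2 * W.card + 2 * k + 2 * Fintype.card A + 1)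
      obtain ⟨b, hb⟩ := hWne
      refine false_of_blocks hd hκ (q := fun _ => (∑ a, v a)⁻¹) (fun _ => hθ.le) ?_ hW hcard
        ⟨b, hb, le_rfl⟩ hθ (k := k) ?_ hf hB (by omega)
      · rw [← Finset.mul_sum, inv_mul_cancel₀ hsum.ne']
      · rw [mul_assoc]
        exact (inv_lt_iff_one_lt_mul₀ (mul_pos hθ hκ0)).mp hk
    · obtain ⟨b, rfl⟩ := Finset.card_eq_one.mp hcard.symm
      obtain ⟨R, hR⟩ := exists_nat_gt (v b / κ)
      obtain ⟨Bs, rfl, hf, hB⟩ := blocks R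
      have hlen : Bs.length ≤ Bs.flatten.length := by
        clear hR hf
        induction Bs with
        | nil => simp
        | cons c Bs ih =>
          have h1 := ih (fun b hb => hB b (by simp [hb]))
          have h2 : 0 < c.length := by
            rw [List.length_pos_iff]
            rintro rfl
            have := hB [] (by simp)
            simp at this
          rw [List.flatten_cons, List.length_append, List.length_cons]
          omega
      have h1 := descend_le_of_arrowNames_subset_singleton hf (arrowNames_flatten_subset hB)
        (fun a ha => hκ.le_of_notMem hd (by simpa using ha))
      have h2 := (hd.descend hf).pos b
      have h3 : (Bs.length : ℝ) * κ ≤ Bs.flatten.length * κ := by gcongr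
      rw [div_lt_iff₀ hκ0] at hR
      linarith

end Exit

/-! ### Weights outside the set of names during runs of equal winners. -/

section RunBounds

variable {A : Type*}

theorem mem_of_getLast?_append_cons {s L : List A} {b c : A}
    (h : (s ++ b :: L).getLast? = some c) (hne : c ≠ b) : c ∈ L := by
  rcases List.eq_nil_or_concat' L with rfl | ⟨L, d, rfl⟩
  · simp [List.getLast?_append] at h
    exact absurd h.symm hne
  · simp [List.getLast?_append, List.getLast?_cons] at h
    simp [h]

variable [DecidableEq A]

theorem sum_update_add (W : Finset A) (q : A → ℝ) (l : A) (x : ℝ) :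
    ∑ a ∈ W, Function.update q l (q l + x) a = ∑ a ∈ W, q a + if l ∈ W then x else 0 := by
  split_ifs with h
  · rw [Finset.sum_update_of_mem h, ← Finset.add_sum_erase _ _ h, Finset.sdiff_singleton_eq_erase]
    ring
  · rw [add_zero]
    refine Finset.sum_congr rfl fun a ha => Function.update_of_ne ?_ _ _
    rintro rfl
    exact h ha

theorem RauzyArrow.sum_weigh (e : RauzyArrow A) (W : Finset A) (q : A → ℝ) :
    ∑ a ∈ W, e.weigh q a = ∑ a ∈ W, q a + if e.loser ∈ W then q e.winner else 0 :=
  sum_update_add W q _ _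

/-- A bound on the weights during a run of arrows with the name `b`, when `r` is the row of the
losers. Letters that precede `b` in `r` do not lose, and those that follow `b` lose in turn. -/
def RunBound (W : Finset A) (K : ℝ) (b : A) (r : List A) (q : A → ℝ) : Prop :=
  (∃ s L, r = s ++ b :: L ∧ ∀ y ∈ W, ∀ u v, L = u ++ y :: v → ∀ x,
    q x + v.count x * q b ≤ K + 2 * ∑ a ∈ W, q a) ∨
  (b ∉ r ∧ ∀ x, q x + r.length * q b ≤ K + 2 * ∑ a ∈ W, q a)

theorem runBound_of_le {W : Finset A} {K : ℝ} {b : A} {r : List A} {q : A → ℝ} {n : ℕ}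
    (hb : 0 ≤ q b) (hr : r.length ≤ n) (h : ∀ x, q x + n * q b ≤ K + 2 * ∑ a ∈ W, q a) :
    RunBound W K b r q := by
  by_cases hbr : b ∈ r
  · obtain ⟨s, L, rfl⟩ := List.append_of_mem hbr
    refine Or.inl ⟨s, L, rfl, ?_⟩
    rintro y - u v rfl x
    have h1 : (v.count x : ℝ) ≤ n := by
      have := v.count_le_length (a := x)
      simp at hr
      exact_mod_cast (by omega)
    have := mul_le_mul_of_nonneg_right h1 hb
    linarith [h x]
  · refine Or.inr ⟨hbr, fun x => ?_⟩
    have h1 : (r.length : ℝ) ≤ n := by exact_mod_cast hr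
    have := mul_le_mul_of_nonneg_right h1 hb
    linarith [h x]

/-- The letters after `b` lose in rotation, from the end of the row. The term `v.count x * q b`
reserves the losses of `x` that come before that of `y`. When a letter of `W` loses, the total
weight of `W` grows by `q b`, which pays for one more round. In the `double` case the row gets
shorter with each loss. -/
theorem RunBound.move {W : Finset A} {K : ℝ} {r₁ r₂ r₁' r₂' : List A} {b l : A} {q : A → ℝ}
    (h : RunBound W K b r₂ q) (hm : RowMove r₁ r₂ b l r₁' r₂')
    (h2 : ∀ a, (r₁ ++ r₂).count a = 2) (hq : ∀ a, 0 ≤ q a) :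
    RunBound W K b r₂' (Function.update q l (q l + q b)) := by
  have hif : 0 ≤ if l ∈ W then q b else 0 := by split_ifs <;> simp [hq]
  have hne := hm.winner_ne_loser h2
  unfold RunBound
  rw [sum_update_add, Function.update_of_ne hne]
  rcases hm.normal_form h2 with ⟨t, b₁, b₂, rfl, rfl, rfl, rfl, -, -, hb1, hb2⟩ |
    ⟨t₁, t₂, B, rfl, rfl, rfl, rfl, -, -, -, hB, -⟩
  · left
    refine ⟨b₁, l :: b₂, rfl, ?_⟩
    rcases h with ⟨s, L, hsL, h⟩ | ⟨hn, -⟩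
    · have hL : L = b₂ ++ [l] := by
        have := (List.append_cons_inj_of_notMem hb1 (by simp [hb2, hne])).mp hsL
        exact this.2.2.symm
      subst hL
      intro y hy u v huv x
      rcases u with _ | ⟨l', u⟩
      · simp only [List.nil_append, List.cons.injEq] at huv
        obtain ⟨rfl, rfl⟩ := huv
        have h0 := h l hy b₂ [] rfl x
        rw [if_pos hy]
        -- In one round `x` loses at most twice; this is the factor 2 before the total weight of
        -- `W`.
        have hc : (b₂ ++ [l]).count x ≤ 2 := by
          have := h2 x
          simp only [List.count_append, List.count_cons] at this ⊢
          omega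
        have hc' : (b₂.count x : ℝ) + (if l = x then 1 else 0) ≤ 2 := by
          rw [List.count_append, List.count_singleton] at hc
          simp only [beq_iff_eq] at hc
          exact_mod_cast hc
        have := mul_le_mul_of_nonneg_right hc' (hq b)
        simp at h0
        by_cases hx : l = x
        · subst hx
          simp at this ⊢
          linarith
        · rw [Function.update_of_ne (Ne.symm hx)]
          simp [hx] at this
          linarith
      · simp only [List.cons_append, List.cons.injEq] at huv
        obtain ⟨rfl, rfl⟩ := huv
        have h0 := h y hy u (v ++ [l]) (by simp) x
        rw [List.count_append, List.count_singleton] at h0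
        by_cases hx : l = x
        · subst hx
          simp at h0 ⊢
          linarith
        · rw [Function.update_of_ne (Ne.symm hx)]
          simp [hx] at h0
          linarith
    · simp at hn
  · right
    refine ⟨hB, fun x => ?_⟩
    rcases h with ⟨s, L, hsL, h⟩ | ⟨-, h⟩
    · have : b ∈ r₂' ++ [l] := by rw [hsL]; simp
      simp [hB, hne] at this
    · have h0 := h x
      rw [List.length_append, List.length_singleton] at h0
      push_cast at h0
      by_cases hx : x = l
      · subst hx
        simp
        linarith
      · rw [Function.update_of_ne hx]
        linarith [hq b]

theorem RunBound.le {W : Finset A} {K : ℝ} {b : A} {r : List A} {q : A → ℝ}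
    (h : RunBound W K b r q) (hb : 0 ≤ q b) :
    (∃ s L, r = s ++ b :: L ∧ ∀ y ∈ L, y ∉ W) ∨ ∀ x, q x ≤ K + 2 * ∑ a ∈ W, q a := by
  rcases h with ⟨s, L, rfl, h⟩ | ⟨-, h⟩
  · by_cases hL : ∀ y ∈ L, y ∉ W
    · exact Or.inl ⟨s, L, rfl, hL⟩
    · push Not at hL
      obtain ⟨y, hyL, hyW⟩ := hL
      obtain ⟨u, v, rfl⟩ := List.append_of_mem hyL
      refine Or.inr fun x => le_trans ?_ (h y hyW u v rfl x)
      have := mul_nonneg (Nat.cast_nonneg (α := ℝ) (v.count x)) hb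
      linarith
  · refine Or.inr fun x => le_trans ?_ (h x)
    have := mul_nonneg (Nat.cast_nonneg (α := ℝ) r.length) hb
    linarith

/-- The letter `b` is the last one of a row, and no letter of `W` follows it in the other row. -/
def Blocked (W : Finset A) (b : A) (π : GenPerm A) : Prop :=
  (π.top.getLast? = some b ∧ ∃ s L, π.bot = s ++ b :: L ∧ ∀ y ∈ L, y ∉ W) ∨
  (π.bot.getLast? = some b ∧ ∃ s L, π.top = s ++ b :: L ∧ ∀ y ∈ L, y ∉ W)

theorem RowMove.blocked {W : Finset A} {r₁ r₂ r₁' r₂' : List A} {b l : A}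
    (hm : RowMove r₁ r₂ b l r₁' r₂') (h2 : ∀ a, (r₁ ++ r₂).count a = 2)
    (h : ∃ s L, r₂ = s ++ b :: L ∧ ∀ y ∈ L, y ∉ W) :
    ∃ s L, r₂' = s ++ b :: L ∧ ∀ y ∈ L, y ∉ W := by
  obtain ⟨s, L, hsL, h⟩ := h
  have hne := hm.winner_ne_loser h2
  rcases hm.normal_form h2 with ⟨t, b₁, b₂, rfl, rfl, rfl, rfl, -, -, hb1, hb2⟩ |
    ⟨t₁, t₂, B, rfl, rfl, rfl, rfl, -, -, -, hB, -⟩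
  · have hL := ((List.append_cons_inj_of_notMem hb1 (by simp [hb2, hne])).mp hsL).2.2
    refine ⟨b₁, l :: b₂, rfl, fun y hy => h y ?_⟩
    rw [← hL]
    simpa [or_comm] using hy
  · have : b ∈ r₂' ++ [l] := by rw [hsL]; simp
    simp [hB, hne] at this

/-- If `b` lost, the winner would be one of the letters that follow `b` in the other row, none of
which is in `W`. -/
theorem Blocked.step {W : Finset A} {b : A} {e : RauzyArrow A} (h : Blocked W b e.source)
    (hw : e.winner ∈ W) : e.winner = b ∧ Blocked W b e.target := by
  rcases h with ⟨hl, h⟩ | ⟨hl, h⟩ <;> rcases e.move with hm | hm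
  · have hb : e.winner = b := by
      have := hm.getLast?_left.symm.trans hl
      simpa using this
    rw [hb] at hm
    exact ⟨hb, Or.inl ⟨hm.getLast?_left', hm.blocked e.source.two h⟩⟩
  · have hb : e.loser = b := by
      have := hm.getLast?_right.symm.trans hl
      simpa using this
    obtain ⟨s, L, hsL, h⟩ := h
    have h1 := hm.getLast?_left
    rw [hsL] at h1
    exact absurd hw (h _ (mem_of_getLast?_append_cons h1 (hb ▸ e.winner_ne_loser)))
  · have hb : e.loser = b := by
      have := hm.getLast?_right.symm.trans hl
      simpa using this
    obtain ⟨s, L, hsL, h⟩ := h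
    have h1 := hm.getLast?_left
    rw [hsL] at h1
    exact absurd hw (h _ (mem_of_getLast?_append_cons h1 (hb ▸ e.winner_ne_loser)))
  · have hb : e.winner = b := by
      have := hm.getLast?_left.symm.trans hl
      simpa using this
    rw [hb] at hm
    exact ⟨hb, Or.inr ⟨hm.getLast?_left', hm.blocked e.source.two' h⟩⟩

theorem Blocked.arrowNames_subset {W : Finset A} {b : A} {π : GenPerm A}
    {δ : List (RauzyArrow A)} (h : Blocked W b π) (hδ : IsRauzyPath π δ)
    (hW : arrowNames δ ⊆ W) : arrowNames δ ⊆ {b} := by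
  induction δ generalizing π with
  | nil => simp
  | cons e δ ih =>
    obtain ⟨rfl, hδ⟩ := hδ
    rw [arrowNames_cons, Finset.insert_subset_iff] at hW ⊢
    obtain ⟨h1, h2⟩ := h.step hW.1
    exact ⟨by simp [h1], ih h2 hδ hW.2⟩

variable [Fintype A]

/-- The bound on the weights at the end of a path whose last name is `b`; here `S` is a lower bound
for the total weight of `W` before the last run. -/
def PathBound (W : Finset A) (b : A) (π : GenPerm A) (q : A → ℝ) : Prop :=
  ∃ S : ℝ, S + q b ≤ ∑ a ∈ W, q a ∧
    ((π.top.getLast? = some b ∧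
        RunBound W ((2 * Fintype.card A : ℕ) * (S + q b)) b π.bot q) ∨
      (π.bot.getLast? = some b ∧
        RunBound W ((2 * Fintype.card A : ℕ) * (S + q b)) b π.top q))

theorem PathBound.le {W : Finset A} {b : A} {π : GenPerm A} {q : A → ℝ}
    (h : PathBound W b π q) (hb : 0 ≤ q b) :
    Blocked W b π ∨ ∀ x, q x ≤ (2 * Fintype.card A + 2 : ℕ) * ∑ a ∈ W, q a := by
  obtain ⟨S, hS, h⟩ := h
  have key : (2 * Fintype.card A : ℕ) * (S + q b) + 2 * ∑ a ∈ W, q a ≤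
      (2 * Fintype.card A + 2 : ℕ) * ∑ a ∈ W, q a := by
    have := mul_le_mul_of_nonneg_left hS (Nat.cast_nonneg (α := ℝ) (2 * Fintype.card A))
    push_cast at this ⊢
    linarith
  rcases h with ⟨hl, h⟩ | ⟨hl, h⟩
  · rcases h.le hb with h | h
    · exact Or.inl (Or.inl ⟨hl, h⟩)
    · exact Or.inr fun x => (h x).trans key
  · rcases h.le hb with h | h
    · exact Or.inl (Or.inr ⟨hl, h⟩)
    · exact Or.inr fun x => (h x).trans key

/-- The extra `2 * card A` copies of the weight of the new winner pay for one loss of every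
occurrence in the losing row. -/
theorem pathBound_of_run_start {W : Finset A} {e : RauzyArrow A} {q : A → ℝ} (hq : ∀ a, 0 ≤ q a)
    {S : ℝ} (h : ∀ x, q x ≤ (2 * Fintype.card A : ℕ) * S + 2 * ∑ a ∈ W, q a)
    (hS : S + q e.winner ≤ ∑ a ∈ W, e.weigh q a) :
    PathBound W e.winner e.target (e.weigh q) := by
  have hlen := e.source.length_add_length
  have hb : e.weigh q e.winner = q e.winner := Function.update_of_ne e.winner_ne_loser _ _
  have h' : ∀ x, q x + (2 * Fintype.card A : ℕ) * q e.winner ≤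
      (2 * Fintype.card A : ℕ) * (S + q e.winner) + 2 * ∑ a ∈ W, q a := by
    intro x
    rw [mul_add]
    linarith [h x]
  refine ⟨S, by rw [hb]; exact hS, ?_⟩
  rw [hb]
  rcases e.move with hm | hm
  · exact Or.inl ⟨hm.getLast?_left',
      (runBound_of_le (hq _) (by omega) h').move hm e.source.two hq⟩
  · exact Or.inr ⟨hm.getLast?_left',
      (runBound_of_le (hq _) (by omega) h').move hm e.source.two' hq⟩

theorem PathBound.step {W : Finset A} {b : A} {e : RauzyArrow A} {q : A → ℝ} (hq : ∀ a, 0 ≤ q a)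
    (h : PathBound W b e.source q) (hb : b ∈ W) (hw : e.winner ∈ W) :
    PathBound W e.winner e.target (e.weigh q) := by
  have hlast : e.winner ≠ b → e.loser = b := by
    intro hne
    obtain ⟨S, -, ⟨hl, -⟩ | ⟨hl, -⟩⟩ := h <;> rcases e.move with hm | hm
    · exact absurd (by simpa using hm.getLast?_left.symm.trans hl) hne
    · simpa using hm.getLast?_right.symm.trans hl
    · simpa using hm.getLast?_right.symm.trans hl
    · exact absurd (by simpa using hm.getLast?_left.symm.trans hl) hne
  by_cases hwb : e.winner = b
  · obtain ⟨S, hS, h⟩ := h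
    have hqb : e.weigh q e.winner = q e.winner := Function.update_of_ne e.winner_ne_loser _ _
    subst hwb
    refine ⟨S, ?_, ?_⟩
    · rw [hqb, e.sum_weigh]
      split_ifs <;> linarith [hq e.winner]
    · rw [hqb]
      rcases h with ⟨hl, h⟩ | ⟨hl, h⟩ <;> rcases e.move with hm | hm
      · exact Or.inl ⟨hm.getLast?_left', h.move hm e.source.two hq⟩
      · exact absurd (by simpa using hl.symm.trans hm.getLast?_right) e.winner_ne_loser
      · exact absurd (by simpa using hl.symm.trans hm.getLast?_right) e.winner_ne_loser
      · exact Or.inr ⟨hm.getLast?_left', h.move hm e.source.two' hq⟩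
  · have hlb := hlast hwb
    rcases h.le (hq b) with hbl | hle
    · exact absurd (hbl.step hw).1 hwb
    -- At a change of winner the old one, which is in `W`, loses. So the total weight of `W`
    -- increases by the weight of the new winner, and the former total can serve as `S`.
    · refine pathBound_of_run_start hq (S := ∑ a ∈ W, q a) (fun x => ?_) ?_
      · have := hle x
        push_cast at this ⊢
        linarith
      · rw [e.sum_weigh, if_pos (hlb ▸ hb)]

theorem pathBound_of_path {W : Finset A} (hW : 1 < W.card) {π : GenPerm A}
    {γ : List (RauzyArrow A)} {e : RauzyArrow A} (hp : IsRauzyPath π (γ ++ [e]))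
    (hγ : arrowNames (γ ++ [e]) ⊆ W) :
    PathBound W e.winner (endpoint π (γ ++ [e])) (weight (γ ++ [e]) 1) := by
  induction γ using List.reverseRecOn generalizing e with
  | nil =>
    have hcard : (2 : ℝ) ≤ W.card := by exact_mod_cast hW
    have hA : (1 : ℝ) ≤ Fintype.card A := by
      exact_mod_cast (by have := W.card_le_univ; omega : 1 ≤ Fintype.card A)
    -- All weights are 1 here, and the first loser need not be in `W`; so room for the weight of the
    -- winner is left in `S`.
    refine pathBound_of_run_start (S := (W.card : ℝ) - 1) (fun _ => zero_le_one) ?_ ?_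
    · intro x
      simp
      nlinarith
    · rw [e.sum_weigh]
      simp
      split_ifs <;> simp
  | append_singleton γ e' ih =>
    have hp' := isRauzyPath_append.mp hp
    have hγ' : arrowNames (γ ++ [e']) ∪ arrowNames [e] ⊆ W := by rwa [← arrowNames_append]
    have h1 := ih hp'.1 (Finset.union_subset_left hγ')
    have he : e.source = endpoint π (γ ++ [e']) := hp'.2.1
    rw [weight_append, endpoint_append]
    refine PathBound.step (b := e'.winner)
      (fun a => zero_le_one.trans (le_weight (q := 1) ?_ a)) (he ▸ h1) ?_ ?_
    · exact fun _ => zero_le_one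
    · exact hγ' (by simp)
    · exact hγ' (by simp)

end RunBounds

/-! ### Bounded integral vectors in general position. -/

section IntegralVectors

/-- Uniqueness of expansions in base 5 with digits from -2 to 2. -/
theorem eq_zero_of_sum_five_pow {n : ℕ} {c : Fin n → ℤ} (hc : ∀ i, |c i| ≤ 2)
    (h : ∑ i : Fin n, 5 ^ (i : ℕ) * c i = 0) : c = 0 := by
  induction n with
  | zero => exact Subsingleton.elim _ _
  | succ n ih =>
    rw [Fin.sum_univ_succ] at h
    have h1 : ∑ i : Fin n, (5 : ℤ) ^ ((i.succ : Fin (n + 1)) : ℕ) * c i.succ =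
        5 * ∑ i : Fin n, 5 ^ (i : ℕ) * c i.succ := by
      rw [Finset.mul_sum]
      refine Finset.sum_congr rfl fun i _ => ?_
      rw [Fin.val_succ, pow_succ]
      ring
    rw [h1] at h
    have h2 := abs_le.mp (hc 0)
    simp at h
    have h3 : c 0 = 0 := by omega
    have h4 := ih (c := fun i => c i.succ) (fun i => hc _) (by omega)
    ext i
    refine Fin.cases h3 (fun i => congrFun h4 i) i

variable {A : Type*} [DecidableEq A] [Fintype A]

/-- The equation `∑ ε a * u a = 0` has a positive integral solution, bounded in terms of the
dimension, that lies on no hyperplane with coefficients in `{-1, 0, 1}`, except for those that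
contain all solutions. -/
theorem exists_integral_vector {ε : A → ℤ} (hε : ∀ a, |ε a| ≤ 1) {v : A → ℝ} (hv : ∀ a, 0 < v a)
    (h0 : ∑ a, (ε a : ℝ) * v a = 0) :
    ∃ u : A → ℤ, (∀ a, 0 < u a) ∧
      (∀ a, u a ≤ 2 * Fintype.card A ^ 2 * 5 ^ (Fintype.card A ^ 2)) ∧ ∑ a, ε a * u a = 0 ∧
      ∀ σ : A → ℤ, (∀ a, |σ a| ≤ 1) → ∑ a, σ a * u a = 0 →
        ∀ w : A → ℝ, ∑ a, (ε a : ℝ) * w a = 0 → ∑ a, (σ a : ℝ) * w a = 0 := by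
  have hcard : Fintype.card (A × A) = Fintype.card A ^ 2 := by rw [Fintype.card_prod, sq]
  let φ : A × A ≃ Fin (Fintype.card A ^ 2) := Fintype.equivFinOfCardEq hcard
  have hε' : ∀ a, ε a = -1 ∨ ε a = 0 ∨ ε a = 1 := by
    intro a
    have := abs_le.mp (hε a)
    omega
  have hex : ∀ s : ℤ, (s = 1 ∨ s = -1) → (∃ a, ε a = s) → ∃ b, ε b = -s := by
    rintro s hs ⟨a, ha⟩
    by_contra! hne
    have : 0 < ∑ a, ((s * ε a : ℤ) : ℝ) * v a := by
      refine Finset.sum_pos' (fun b _ => mul_nonneg ?_ (hv b).le)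
        ⟨a, Finset.mem_univ _, mul_pos ?_ (hv a)⟩
      · have := hε' b
        have := hne b
        have : 0 ≤ s * ε b := by
          rcases hs with rfl | rfl <;> omega
        exact_mod_cast this
      · rw [ha]
        rcases hs with rfl | rfl <;> simp
    have h3 : ∑ a, ((s * ε a : ℤ) : ℝ) * v a = s * ∑ a, (ε a : ℝ) * v a := by
      rw [Finset.mul_sum]
      refine Finset.sum_congr rfl fun b _ => ?_
      push_cast
      ring
    rw [h3, h0, mul_zero] at this
    exact lt_irrefl _ this
  -- Nonnegative solutions of the equation: a pair of unit vectors with opposite signs of `ε`, or a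
  -- unit vector where `ε` vanishes. A form with coefficients in `{-1, 0, 1}` takes values from -2
  -- to 2 on them.
  let g : A × A → A → ℤ := fun p =>
    if ε p.1 = 1 ∧ ε p.2 = -1 then Pi.single p.1 1 + Pi.single p.2 1
    else if p.1 = p.2 ∧ ε p.1 = 0 then Pi.single p.1 1 else 0
  have hg : ∀ (σ : A → ℤ) p, ∑ a, σ a * g p a =
      if ε p.1 = 1 ∧ ε p.2 = -1 then σ p.1 + σ p.2
      else if p.1 = p.2 ∧ ε p.1 = 0 then σ p.1 else 0 := by
    intro σ p
    simp only [g]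
    split_ifs
    · simp [mul_add, Finset.sum_add_distrib, Pi.single_apply]
    · simp [Pi.single_apply]
    · simp
  have hg0 : ∀ p a, 0 ≤ g p a := by
    intro p a
    simp only [g]
    split_ifs <;> simp [Pi.single_apply] <;> split_ifs <;> simp
  have hg2 : ∀ p a, g p a ≤ 2 := by
    intro p a
    simp only [g]
    split_ifs <;> simp [Pi.single_apply] <;> split_ifs <;> simp
  have hgpos : ∀ a, ∃ p, 0 < g p a := by
    intro a
    rcases hε' a with h | h | h
    · obtain ⟨b, hb⟩ := hex (-1) (Or.inr rfl) ⟨a, h⟩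
      refine ⟨(b, a), ?_⟩
      simp only [g, hb, h]
      simp [Pi.single_apply]
      split_ifs <;> simp
    · exact ⟨(a, a), by simp [g, h]⟩
    · obtain ⟨b, hb⟩ := hex 1 (Or.inl rfl) ⟨a, h⟩
      refine ⟨(a, b), ?_⟩
      simp only [g, hb, h]
      simp [Pi.single_apply]
      split_ifs <;> simp
  -- The value of a form at `u` has its values on the `g p` as digits in base 5; if it is zero, the
  -- form vanishes on every `g p` and is a multiple of `ε`.
  let u : A → ℤ := fun a => ∑ p, 5 ^ (φ p : ℕ) * g p a
  have hu : ∀ σ : A → ℤ, ∑ a, σ a * u a = ∑ p, 5 ^ (φ p : ℕ) * ∑ a, σ a * g p a := by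
    intro σ
    simp only [u, Finset.mul_sum]
    rw [Finset.sum_comm]
    exact Finset.sum_congr rfl fun _ _ => Finset.sum_congr rfl fun _ _ => by ring
  refine ⟨u, fun a => ?_, fun a => ?_, ?_, fun σ hσ hσu w hw => ?_⟩
  · obtain ⟨p, hp⟩ := hgpos a
    exact Finset.sum_pos' (fun p _ => mul_nonneg (by positivity) (hg0 p a))
      ⟨p, Finset.mem_univ _, mul_pos (by positivity) hp⟩
  · calc u a ≤ ∑ p : A × A, 5 ^ (Fintype.card A ^ 2) * 2 := by
          refine Finset.sum_le_sum fun p _ => mul_le_mul ?_ (hg2 p a) (hg0 p a) (by positivity)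
          exact pow_le_pow_right₀ (by norm_num) (φ p).2.le
      _ = _ := by
          rw [Finset.sum_const, Finset.card_univ, hcard, nsmul_eq_mul]
          push_cast
          ring
  · rw [hu]
    refine Finset.sum_eq_zero fun p _ => ?_
    rw [hg]
    split_ifs with h1 h2
    · rw [h1.1, h1.2]; simp
    · rw [h2.2]; simp
    · simp
  · rw [hu] at hσu
    have hzero : ∀ p, ∑ a, σ a * g p a = 0 := by
      have h1 := eq_zero_of_sum_five_pow (c := fun i => ∑ a, σ a * g (φ.symm i) a) ?_ ?_
      · intro p
        have := congrFun h1 (φ p)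
        simpa using this
      · intro i
        rw [hg]
        have h1 := abs_le.mp (hσ (φ.symm i).1)
        have h2 := abs_le.mp (hσ (φ.symm i).2)
        split_ifs <;> rw [abs_le] <;> constructor <;> omega
      · rw [← hσu, ← φ.sum_comp]
        simp
    have hpair : ∀ a b, ε a = 1 → ε b = -1 → σ a + σ b = 0 := by
      intro a b ha hb
      have := hzero (a, b)
      rwa [hg, if_pos ⟨ha, hb⟩] at this
    have hsimple : ∀ a, ε a = 0 → σ a = 0 := by
      intro a ha
      have := hzero (a, a)
      rwa [hg, if_neg (by simp [ha]), if_pos ⟨rfl, ha⟩] at this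
    obtain ⟨s, hs⟩ : ∃ s : ℤ, ∀ a, σ a = s * ε a := by
      by_cases h1 : ∃ a, ε a = 1
      · obtain ⟨b, hb⟩ := hex 1 (Or.inl rfl) h1
        obtain ⟨a, ha⟩ := h1
        refine ⟨σ a, fun c => ?_⟩
        have := hpair a b ha hb
        rcases hε' c with h | h | h
        · have := hpair a c ha h
          rw [h]; omega
        · rw [h, hsimple c h]; simp
        · have := hpair c b h hb
          rw [h]; omega
      · refine ⟨0, fun a => ?_⟩
        rcases hε' a with h | h | h
        · exact absurd (hex (-1) (Or.inr rfl) ⟨a, h⟩) (by simpa using h1)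
        · rw [hsimple a h]; simp
        · exact absurd ⟨a, h⟩ h1
    calc ∑ a, (σ a : ℝ) * w a = s * ∑ a, (ε a : ℝ) * w a := by
          rw [Finset.mul_sum]
          refine Finset.sum_congr rfl fun a _ => ?_
          rw [hs a]
          push_cast
          ring
      _ = 0 := by rw [hw, mul_zero]

end IntegralVectors

/-! ### Volume comparison by shears. -/

section Shears

open scoped Pointwise

/-- If every point of `S` is moved into `ρ • G` by one of finitely many expanding shears, then `G`
is not much smaller than `S`. -/
theorem measure_le_of_transvections {E : Type*} [NormedAddCommGroup E] [NormedSpace ℝ E]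
    [MeasurableSpace E] [BorelSpace E] [FiniteDimensional ℝ E] (μ : Measure E) [μ.IsAddHaarMeasure]
    {s : E →ₗ[ℝ] ℝ} {U : E} (hU : 0 ≤ s U) {m n : ℕ} (hn : Module.finrank ℝ E ≤ n) {ρ : ℝ}
    (hρ : 1 ≤ ρ) {S G : Set E} (h : ∀ x ∈ S, ∃ j < m, ρ⁻¹ • (x + s x • ((j : ℝ) • U)) ∈ G) :
    μ S ≤ ENNReal.ofReal (m * ρ ^ n) * μ G := by
  have hρ0 : 0 < ρ := by linarith
  let f : ℕ → E →ₗ[ℝ] E := fun j => LinearMap.transvection s ((j : ℝ) • U)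
  have hdet : ∀ j, 1 ≤ LinearMap.det (f j) := by
    intro j
    rw [LinearMap.transvection.det, map_smul, smul_eq_mul]
    have := mul_nonneg (Nat.cast_nonneg (α := ℝ) j) hU
    linarith
  have hsub : S ⊆ ⋃ j ∈ Finset.range m, f j ⁻¹' (ρ • G) := by
    intro x hx
    obtain ⟨j, hj, hG⟩ := h x hx
    simp only [Set.mem_iUnion, Finset.mem_range]
    refine ⟨j, hj, ?_⟩
    rw [Set.mem_preimage, Set.mem_smul_set_iff_inv_smul_mem₀ hρ0.ne']
    exact hG
  -- The determinant of `f j` is `1 + j * s U ≥ 1`, so taking preimages does not increase the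
  -- measure.
  have hle : ∀ j, μ (f j ⁻¹' (ρ • G)) ≤ ENNReal.ofReal (ρ ^ n) * μ G := by
    intro j
    have h1 := hdet j
    rw [Measure.addHaar_preimage_linearMap μ (by linarith : LinearMap.det (f j) ≠ 0),
      Measure.addHaar_smul]
    calc _ ≤ 1 * (ENNReal.ofReal |ρ ^ Module.finrank ℝ E| * μ G) := by
          gcongr
          rw [← ENNReal.ofReal_one]
          refine ENNReal.ofReal_le_ofReal ?_
          rw [abs_of_nonneg (inv_nonneg.mpr (by linarith))]
          exact inv_le_one_of_one_le₀ h1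
      _ ≤ _ := by
          rw [one_mul, abs_of_nonneg (by positivity)]
          gcongr
  calc μ S ≤ μ (⋃ j ∈ Finset.range m, f j ⁻¹' (ρ • G)) := measure_mono hsub
    _ ≤ ∑ j ∈ Finset.range m, μ (f j ⁻¹' (ρ • G)) := measure_biUnion_finset_le _ _
    _ ≤ ∑ j ∈ Finset.range m, ENNReal.ofReal (ρ ^ n) * μ G := Finset.sum_le_sum fun j _ => hle j
    _ = _ := by
        rw [Finset.sum_const, Finset.card_range, nsmul_eq_mul, ENNReal.ofReal_mul (by positivity),
          ENNReal.ofReal_natCast, mul_assoc]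

end Shears

/-! ### Bounded exit in the two cases of the dichotomy. -/

section DeterministicExit

variable {A : Type*} [DecidableEq A]

theorem CoveredBySegments.mono {l l' s : ℕ} {w : List (RauzyArrow A)} (h : CoveredBySegments l s w)
    (hl : l ≤ l') : CoveredBySegments l' s w := by
  obtain ⟨L, h1, h2⟩ := h
  exact ⟨L, h1.trans hl, h2⟩

theorem CoveredBySegments.cons {l s : ℕ} {w : List (RauzyArrow A)} (h : CoveredBySegments l s w)
    (hs : 1 ≤ s) (e : RauzyArrow A) : CoveredBySegments (l + 1) s (e :: w) := by
  obtain ⟨L, h1, rfl, h3⟩ := h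
  refine ⟨[e] :: L, by simpa using h1, by simp, List.forall_mem_cons.mpr ⟨by simpa using hs, h3⟩⟩

/-- After the path `γ`, the length datum `(π, v)` leaves the set of names of `γ`, and before that
its path is covered by at most `l` segments with fewer names than `γ`. -/
def ExitsWithin (l : ℕ) (π : GenPerm A) (v : A → ℝ) (γ : List (RauzyArrow A)) : Prop :=
  ∃ (δ : List (RauzyArrow A)) (e : RauzyArrow A), RauzyFollows π v (γ ++ δ ++ [e]) ∧
    e.winner ∉ arrowNames γ ∧
    CoveredBySegments l ((arrowNames γ).card - 1) (γ.drop (γ.length - 1) ++ δ)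

variable [Fintype A] {π : GenPerm A} {v : A → ℝ} {γ : List (RauzyArrow A)} {e : RauzyArrow A}

theorem exitsWithin_of_blocked (hd : LengthDatum π v) (hg : π.Generic v)
    (hf : RauzyFollows π v (γ ++ [e])) (hW : arrowNames (γ ++ [e]) ≠ Finset.univ)
    (hcard : 1 < (arrowNames (γ ++ [e])).card)
    (hb : Blocked (arrowNames (γ ++ [e])) e.winner (endpoint π (γ ++ [e]))) :
    ExitsWithin 1 π v (γ ++ [e]) := by
  obtain ⟨δ, e', h1, h2, h3⟩ := (hd.descend hf).exists_exit
    (hcard.trans_le (Finset.card_le_univ _)) _ hW (hg.descend hf.isRauzyPath)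
  refine ⟨δ, e', by simpa using rauzyFollows_append.mpr ⟨hf, h1⟩, h3, ?_⟩
  have h4 := hb.arrowNames_subset (isRauzyPath_append.mp h1.isRauzyPath).1 h2
  refine ⟨[(γ ++ [e]).drop ((γ ++ [e]).length - 1) ++ δ], by simp, by simp, ?_⟩
  have h5 : (γ ++ [e]).drop ((γ ++ [e]).length - 1) = [e] := by simp
  rw [h5]
  simp only [List.mem_singleton, forall_eq, List.singleton_append, arrowNames_cons]
  have h6 : insert e.winner (arrowNames δ) ⊆ {e.winner} :=
    Finset.insert_subset (by simp) h4
  have := Finset.card_le_card h6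
  simp at this
  omega

theorem exitsWithin_of_separated {k : ℕ} {κ θ : ℝ} (hd : LengthDatum π v) (hg : π.Generic v)
    (hv : ∑ a, v a = 1)
    (hf : RauzyFollows π v (γ ++ [e])) (hW : arrowNames (γ ++ [e]) ≠ Finset.univ)
    (hcard : 1 < (arrowNames (γ ++ [e])).card)
    (hs : Separated (arrowNames (γ ++ [e])) κ π v)
    (hθ : ∃ a ∈ arrowNames (γ ++ [e]), θ ≤ weight (γ ++ [e]) 1 a) (hθ0 : 0 < θ)
    (hκ : 1 < 2 ^ k * θ * κ) :
    ExitsWithin (2 * (4 * Fintype.card A + 2 * k + 1) + 1) π v (γ ++ [e]) := by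
  have hA := Finset.card_le_univ (arrowNames (γ ++ [e]))
  obtain ⟨δ, e', h1, h2, h3⟩ := (hd.descend hf).exists_exit
    (hcard.trans_le hA) _ hW (hg.descend hf.isRauzyPath)
  refine ⟨δ, e', by simpa using rauzyFollows_append.mpr ⟨hf, h1⟩, h3, ?_⟩
  have h5 : (γ ++ [e]).drop ((γ ++ [e]).length - 1) = [e] := by simp
  rw [h5, List.singleton_append]
  refine CoveredBySegments.cons ?_ (by omega) e
  refine (coveredBySegments_or_exists_blocks hcard _ h2).resolve_right ?_
  rintro ⟨Bs, r, hl, rfl, hB⟩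
  have hq : ∀ a : A, (0 : ℝ) ≤ (1 : A → ℝ) a := fun _ => zero_le_one
  rw [List.append_assoc] at h1
  refine false_of_blocks (hd.descend hf) (hs.descend hf.isRauzyPath le_rfl)
    (q := weight (γ ++ [e]) 1) (fun a => (hq a).trans (le_weight hq a)) ?_ hW hcard hθ hθ0 hκ
    (rauzyFollows_append.mp h1).1 hB (by omega)
  rw [sum_weight_mul_descend]
  simp [hv]

end DeterministicExit

/-! ### Good directions in the cone of a path. -/

section Cones

variable {A : Type*} [DecidableEq A]

theorem RauzyFollows.add {π : GenPerm A} {v w : A → ℝ} {γ : List (RauzyArrow A)}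
    (hv : RauzyFollows π v γ) (hw : RauzyFollows π w γ) : RauzyFollows π (v + w) γ := by
  induction γ generalizing π v w with
  | nil => trivial
  | cons e γ ih =>
    refine ⟨hv.1, add_lt_add hv.2.1 hw.2.1, ?_⟩
    convert ih hv.2.2 hw.2.2 using 1
    ext a
    by_cases ha : a = e.winner
    · subst ha; simp; ring
    · simp [ha]

theorem RauzyFollows.smul {π : GenPerm A} {v : A → ℝ} {γ : List (RauzyArrow A)}
    (hv : RauzyFollows π v γ) {t : ℝ} (ht : 0 < t) : RauzyFollows π (t • v) γ := by
  induction γ generalizing π v with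
  | nil => trivial
  | cons e γ ih =>
    refine ⟨hv.1, mul_lt_mul_of_pos_left hv.2.1 ht, ?_⟩
    convert ih hv.2.2 using 1
    ext a
    by_cases ha : a = e.winner
    · subst ha; simp; ring
    · simp [ha]

theorem measurableSet_rauzyFollows (π : GenPerm A) (γ : List (RauzyArrow A)) :
    MeasurableSet {v : A → ℝ | RauzyFollows π v γ} := by
  induction γ generalizing π with
  | nil => simp [RauzyFollows]
  | cons e γ ih =>
    have hstep : Measurable fun v : A → ℝ =>
        Function.update v e.winner (v e.winner - v e.loser) := by
      refine measurable_pi_iff.mpr fun a => ?_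
      by_cases ha : a = e.winner
      · subst ha
        simp only [Function.update_self]
        exact (measurable_pi_apply e.winner).sub (measurable_pi_apply e.loser)
      · simpa [ha] using measurable_pi_apply a
    have hlt : MeasurableSet {v : A → ℝ | v e.loser < v e.winner} :=
      measurableSet_lt (measurable_pi_apply _) (measurable_pi_apply _)
    exact (MeasurableSet.const (e.source = π)).inter (hlt.inter (hstep (ih e.target)))

variable [Fintype A]

theorem isBalanced_iff_sum (π : GenPerm A) (u : A → ℝ) :
    π.IsBalanced u ↔ ∑ a, (((π.top.count a : ℤ) - 1 : ℤ) : ℝ) * u a = 0 := by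
  have h : rowSum π.top u - rowSum π.bot u =
      2 * ∑ a, (((π.top.count a : ℤ) - 1 : ℤ) : ℝ) * u a := by
    rw [rowSum_eq_sum, rowSum_eq_sum, ← Finset.sum_sub_distrib, Finset.mul_sum]
    refine Finset.sum_congr rfl fun a _ => ?_
    have h2 : (π.top.count a : ℝ) + π.bot.count a = 2 := by
      have := π.two a
      rw [List.count_append] at this
      exact_mod_cast this
    push_cast
    linear_combination (-u a) * h2
  unfold GenPerm.IsBalanced
  rw [← sub_eq_zero, h]
  simp

/-- A positive vector after `γ` that is bounded in terms of the dimension, and on which the linear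
forms with coefficients in `{-1, 0, 1}` are bounded away from zero. -/
theorem exists_generic_vector {π : GenPerm A} {v : A → ℝ} (hv : ∀ a, 0 < v a)
    (hb : π.IsBalanced v) :
    ∃ u : A → ℝ, (∀ a, 0 < u a) ∧ π.IsBalanced u ∧
      ∑ a, u a ≤ Fintype.card A * (2 * Fintype.card A ^ 2 * 5 ^ (Fintype.card A ^ 2)) ∧
      ∀ σ : A → ℤ, (∀ a, |σ a| ≤ 1) → (∃ w, π.IsBalanced w ∧ ∑ a, (σ a : ℝ) * w a ≠ 0) →
        1 ≤ |∑ a, (σ a : ℝ) * u a| := by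
  obtain ⟨u, h1, h2, h3, h4⟩ := exists_integral_vector (ε := fun a => (π.top.count a : ℤ) - 1)
    (fun a => by
      have := π.two a
      rw [List.count_append] at this
      rw [abs_le]
      constructor <;> omega) hv ((isBalanced_iff_sum π v).mp hb)
  refine ⟨fun a => u a, fun a => Int.cast_pos.mpr (h1 a), ?_, ?_, ?_⟩
  · rw [isBalanced_iff_sum]
    exact_mod_cast h3
  · calc ∑ a, (u a : ℝ) ≤ ∑ _a : A, (2 * Fintype.card A ^ 2 * 5 ^ (Fintype.card A ^ 2) : ℝ) :=
          Finset.sum_le_sum fun a _ => by exact_mod_cast h2 a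
      _ = _ := by rw [Finset.sum_const, Finset.card_univ, nsmul_eq_mul]
  · rintro σ hσ ⟨w, hw, hne⟩
    have : ∑ a, σ a * u a ≠ 0 := fun h => hne (h4 σ hσ h w ((isBalanced_iff_sum π w).mp hw))
    have := Int.one_le_abs this
    beta_reduce
    exact_mod_cast this

theorem sum_mul_descend_of_eq_zero {γ : List (RauzyArrow A)} {σ : A → ℤ}
    (h : ∀ a ∈ arrowNames γ, σ a = 0) (u : A → ℝ) :
    ∑ a, (σ a : ℝ) * descend γ u a = ∑ a, (σ a : ℝ) * u a := by
  refine Finset.sum_congr rfl fun a _ => ?_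
  by_cases ha : a ∈ arrowNames γ
  · simp [h a ha]
  · rw [descend_of_notMem ha]

theorem sum_mul_ascend_of_eq_zero {γ : List (RauzyArrow A)} {σ : A → ℤ}
    (h : ∀ a ∈ arrowNames γ, σ a = 0) (u : A → ℝ) :
    ∑ a, (σ a : ℝ) * ascend γ u a = ∑ a, (σ a : ℝ) * u a := by
  rw [← sum_mul_descend_of_eq_zero h, descend_ascend]

/-- A direction in which the linear forms supported off the names of `γ` are as large as the
weights permit. -/
theorem exists_direction {π : GenPerm A} {v : A → ℝ} (hd : LengthDatum π v)
    {γ : List (RauzyArrow A)} (hf : RauzyFollows π v γ) {P : ℝ} (hP : 0 < P)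
    (hq : ∀ a, weight γ 1 a ≤ P) :
    ∃ U : A → ℝ, (∀ a, 0 < U a) ∧ π.IsBalanced U ∧ RauzyFollows π U γ ∧
      ∑ a, U a ≤ Fintype.card A * (2 * Fintype.card A ^ 2 * 5 ^ (Fintype.card A ^ 2)) ∧
      ∀ σ : A → ℤ, (∀ a, |σ a| ≤ 1) → (∀ a ∈ arrowNames γ, σ a = 0) →
        (∃ w, π.IsBalanced w ∧ ∑ a, (σ a : ℝ) * w a ≠ 0) → 1 ≤ P * |∑ a, (σ a : ℝ) * U a| := by
  obtain ⟨u, h1, h2, h3, h4⟩ := exists_generic_vector (hd.descend hf).pos (hd.descend hf).balanced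
  have hpath := hf.isRauzyPath
  have hP' : 0 < P⁻¹ := inv_pos.mpr hP
  have hbal : ∀ w : A → ℝ, π.IsBalanced w → π.IsBalanced (P⁻¹ • w) := by
    intro w hw
    rw [isBalanced_iff_sum] at hw ⊢
    simp only [Pi.smul_apply, smul_eq_mul, mul_left_comm _ P⁻¹, ← Finset.mul_sum, hw, mul_zero]
  -- `ascend` changes only coordinates named in `γ`, so the forms considered keep their values at
  -- `u`. It multiplies total length by at most `P`, hence the normalization.
  refine ⟨P⁻¹ • ascend γ u, fun a => mul_pos hP' (ascend_pos h1 a),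
    hbal _ ((isBalanced_ascend_iff hpath u).mpr h2),
    (rauzyFollows_ascend hpath h1).smul hP', ?_, ?_⟩
  · refine le_trans ?_ h3
    have := sum_weight_mul_descend γ 1 (ascend γ u)
    rw [descend_ascend] at this
    simp only [Pi.one_apply, one_mul] at this
    simp only [Pi.smul_apply, smul_eq_mul, ← Finset.mul_sum]
    rw [← this, inv_mul_le_iff₀ hP, Finset.mul_sum]
    exact Finset.sum_le_sum fun a _ => mul_le_mul_of_nonneg_right (hq a) (h1 a).le
  · rintro σ hσ h0 ⟨w, hw, hne⟩
    have := h4 σ hσ ⟨descend γ w, ?_, by rwa [sum_mul_descend_of_eq_zero h0]⟩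
    · simp only [Pi.smul_apply, smul_eq_mul, mul_left_comm _ P⁻¹, ← Finset.mul_sum]
      rw [sum_mul_ascend_of_eq_zero h0, abs_mul, abs_of_pos hP', ← mul_assoc,
        mul_inv_cancel₀ hP.ne', one_mul]
      exact this
    · rw [← isBalanced_ascend_iff hpath, ascend_descend]
      exact hw

/-- The linear forms with coefficients in `{-1, 0, 1}` supported off `W`, if not identically zero on
the balanced vectors, are bounded below by `κ * ∑ v` at `v`. -/
def GoodDirection (W : Finset A) (κ : ℝ) (π : GenPerm A) (v : A → ℝ) : Prop :=
  ∀ σ : A → ℤ, (∀ a, |σ a| ≤ 1) → (∀ a ∈ W, σ a = 0) →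
    (∃ w, π.IsBalanced w ∧ ∑ a, (σ a : ℝ) * w a ≠ 0) →
    κ * ∑ a, v a ≤ |∑ a, (σ a : ℝ) * v a|

theorem GoodDirection.smul {W : Finset A} {κ : ℝ} {π : GenPerm A} {v : A → ℝ}
    (h : GoodDirection W κ π v) {t : ℝ} (ht : 0 < t) : GoodDirection W κ π (t • v) := by
  intro σ h1 h2 h3
  have := mul_le_mul_of_nonneg_left (h σ h1 h2 h3) ht.le
  simp only [Pi.smul_apply, smul_eq_mul, mul_left_comm _ t, ← Finset.mul_sum]
  rw [abs_mul, abs_of_pos ht]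
  linarith

/-- Among sufficiently many multiples of a direction `U`, one is good to move `v` along. -/
theorem exists_goodDirection {W : Finset A} {π : GenPerm A} {P M : ℝ} (hP : 0 < P) {v U : A → ℝ}
    (hU0 : ∀ a, 0 < U a)
    (hUM : ∑ a, U a ≤ M)
    (hU : ∀ σ : A → ℤ, (∀ a, |σ a| ≤ 1) → (∀ a ∈ W, σ a = 0) →
        (∃ w, π.IsBalanced w ∧ ∑ a, (σ a : ℝ) * w a ≠ 0) → 1 ≤ P * |∑ a, (σ a : ℝ) * U a|)
    (hv : 0 < ∑ a, v a) :
    ∃ j : ℕ, j < 3 ^ Fintype.card A + 1 ∧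
      GoodDirection W (2 * (1 + (3 ^ Fintype.card A + 1 : ℕ) * M) * P)⁻¹ π
        (v + (∑ a, v a) • ((j : ℝ) • U)) := by
  classical
  set s := ∑ a, v a with hs
  set m := 3 ^ Fintype.card A + 1 with hm
  have hval : ∀ (σ : A → ℤ) (j : ℕ), ∑ a, (σ a : ℝ) * (v + s • ((j : ℝ) • U)) a =
      ∑ a, (σ a : ℝ) * v a + j * (s * ∑ a, (σ a : ℝ) * U a) := by
    intro σ j
    simp only [Pi.add_apply, Pi.smul_apply, smul_eq_mul, mul_add, Finset.sum_add_distrib,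
      Finset.mul_sum]
    congr 1
    exact Finset.sum_congr rfl fun a _ => by ring
  let bad : (A → ℤ) → Finset ℕ := fun σ => (Finset.range m).filter fun j =>
    1 ≤ P * |∑ a, (σ a : ℝ) * U a| ∧
      2 * P * |∑ a, (σ a : ℝ) * (v + s • ((j : ℝ) • U)) a| < s
  -- Two values of `j` change the form by at least `s * |σ(U)| ≥ s / P`, so they cannot both give
  -- values smaller than `s / (2 * P)`.
  have hbad : ∀ σ, (bad σ).card ≤ 1 := by
    intro σ
    rw [Finset.card_le_one]
    intro i hi j hj
    by_contra hij
    simp only [bad, Finset.mem_filter, hval] at hi hj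
    set x := ∑ a, (σ a : ℝ) * v a
    set y := ∑ a, (σ a : ℝ) * U a
    have h1 : (1 : ℝ) ≤ |(i : ℝ) - j| := by
      have : (1 : ℤ) ≤ |(i : ℤ) - j| := Int.one_le_abs (by omega)
      exact_mod_cast this
    have h2 : |((i : ℝ) - j) * (s * y)| ≤ |x + i * (s * y)| + |x + j * (s * y)| := by
      have := abs_sub (x + i * (s * y)) (x + j * (s * y))
      rwa [show x + i * (s * y) - (x + j * (s * y)) = ((i : ℝ) - j) * (s * y) by ring] at this
    rw [abs_mul, abs_mul, abs_of_pos hv] at h2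
    have h3 : s * |y| ≤ |(i : ℝ) - j| * (s * |y|) :=
      le_mul_of_one_le_left (mul_nonneg hv.le (abs_nonneg _)) h1
    have h4 : s ≤ s * (P * |y|) := le_mul_of_one_le_right hv.le hi.2.1
    have h5 : P * (s * |y|) ≤ P * (|x + i * (s * y)| + |x + j * (s * y)|) :=
      mul_le_mul_of_nonneg_left (h3.trans h2) hP.le
    linarith [hi.2.2, hj.2.2]
  -- There are `3 ^ card A` forms, each excluding at most one of `3 ^ card A + 1` values of `j`.
  have hcard : ((Finset.Icc (-1 : A → ℤ) 1).biUnion bad).card < (Finset.range m).card := by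
    refine lt_of_le_of_lt (Finset.card_biUnion_le_card_mul _ _ 1 fun σ _ => hbad σ) ?_
    rw [Pi.card_Icc]
    simp [hm]
  obtain ⟨j, hj, hjb⟩ := Finset.exists_mem_notMem_of_card_lt_card hcard
  refine ⟨j, Finset.mem_range.mp hj, fun σ h1 h2 h3 => ?_⟩
  have hmem : σ ∈ Finset.Icc (-1 : A → ℤ) 1 := by
    rw [Finset.mem_Icc]
    exact ⟨fun a => (abs_le.mp (h1 a)).1, fun a => (abs_le.mp (h1 a)).2⟩
  have hnb : j ∉ bad σ := fun h => hjb (Finset.mem_biUnion.mpr ⟨σ, hmem, h⟩)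
  have hle : s ≤ 2 * P * |∑ a, (σ a : ℝ) * (v + s • ((j : ℝ) • U)) a| := by
    by_contra! h
    exact hnb (Finset.mem_filter.mpr ⟨hj, hU σ h1 h2 h3, h⟩)
  have hM : 0 ≤ ∑ a, U a := Finset.sum_nonneg fun a _ => (hU0 a).le
  have hsum : ∑ a, (v + s • ((j : ℝ) • U)) a ≤ (1 + m * M) * s := by
    have : ∑ a, (v + s • ((j : ℝ) • U)) a = s + s * (j * ∑ a, U a) := by
      simp only [Pi.add_apply, Pi.smul_apply, smul_eq_mul, Finset.sum_add_distrib, Finset.mul_sum,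
        hs]
    rw [this]
    have hjm : (j : ℝ) ≤ m := by exact_mod_cast (Finset.mem_range.mp hj).le
    have := mul_le_mul hjm hUM hM (Nat.cast_nonneg m)
    have := mul_le_mul_of_nonneg_left this hv.le
    linarith
  have hρ : 0 < 1 + (m : ℝ) * M := by
    have := mul_nonneg (Nat.cast_nonneg (α := ℝ) m) (hM.trans hUM)
    linarith
  rw [inv_mul_le_iff₀ (by positivity)]
  calc _ ≤ (1 + m * M) * s := hsum
    _ ≤ (1 + m * M) * (2 * P * |∑ a, (σ a : ℝ) * (v + s • ((j : ℝ) • U)) a|) :=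
        mul_le_mul_of_nonneg_left hle hρ.le
    _ = _ := by ring

end Cones

/-! ### Measurability, null sets and the proportion of good data. -/

section Volumes

theorem measurable_form {A : Type*} [Fintype A] (n : A → ℝ) :
    Measurable fun v : A → ℝ => ∑ a, n a * v a :=
  Finset.measurable_sum _ fun a _ => (measurable_pi_apply a).const_mul _

variable {A : Type*} [DecidableEq A] {π : GenPerm A}

theorem lengthSpace_isBalanced (v : π.lengthSpace) : π.IsBalanced fun a => v.1 a := v.2

variable [Fintype A]

/-- The vector of `π.lengthSpace` with the coordinates of a balanced function. -/
def GenPerm.IsBalanced.toLengthSpace {u : A → ℝ} (h : π.IsBalanced u) : π.lengthSpace :=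
  ⟨WithLp.toLp 2 u, h⟩

/-- A linear form on `π.lengthSpace` given by its coefficients. -/
def coordForm (π : GenPerm A) (n : A → ℝ) : π.lengthSpace →ₗ[ℝ] ℝ where
  toFun v := ∑ a, n a * v.1 a
  map_add' v w := by simp [mul_add, Finset.sum_add_distrib]
  map_smul' c v := by simp [Finset.mul_sum, mul_left_comm]

theorem measurable_coord (π : GenPerm A) : Measurable fun (v : π.lengthSpace) (a : A) => v.1 a := by
  refine measurable_pi_iff.mpr fun a => ?_
  have : Continuous fun v : π.lengthSpace => v.1 a := by fun_prop
  exact this.measurable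

theorem measurableSet_rauzySimplex (γ : List (RauzyArrow A)) :
    MeasurableSet (rauzySimplex π γ) := by
  have h1 : MeasurableSet {v : A → ℝ | ∀ a, 0 < v a} := by
    rw [Set.ofPred_forall]
    exact MeasurableSet.iInter fun a => measurableSet_lt measurable_const (measurable_pi_apply a)
  have h2 : MeasurableSet {v : A → ℝ | ∑ a, v a = 1} :=
    measurableSet_eq_fun (Finset.measurable_sum _ fun a _ => measurable_pi_apply a) measurable_const
  exact measurable_coord π (h1.inter (h2.inter (measurableSet_rauzyFollows π γ)))

theorem measurableSet_generic : MeasurableSet {v : A → ℝ | π.Generic v} := by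
  have : {v : A → ℝ | π.Generic v} = ⋂ n : A → ℤ, {v : A → ℝ |
      (∃ u, π.IsBalanced u ∧ ∑ a, (n a : ℝ) * u a ≠ 0) → ∑ a, (n a : ℝ) * v a ≠ 0} := by
    ext v
    simp [GenPerm.Generic]
  rw [this]
  exact MeasurableSet.iInter fun n => (MeasurableSet.const _).imp
    (measurableSet_eq_fun (measurable_form _) measurable_const).compl

theorem measurableSet_goodDirection (W : Finset A) (κ : ℝ) :
    MeasurableSet {v : A → ℝ | GoodDirection W κ π v} := by
  have : {v : A → ℝ | GoodDirection W κ π v} = ⋂ σ : A → ℤ, {v : A → ℝ |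
      (∀ a, |σ a| ≤ 1) → (∀ a ∈ W, σ a = 0) →
      (∃ w, π.IsBalanced w ∧ ∑ a, (σ a : ℝ) * w a ≠ 0) →
      κ * ∑ a, v a ≤ |∑ a, (σ a : ℝ) * v a|} := by
    ext v
    simp [GoodDirection]
  rw [this]
  refine MeasurableSet.iInter fun σ => (MeasurableSet.const _).imp ((MeasurableSet.const _).imp
    ((MeasurableSet.const _).imp ?_))
  exact measurableSet_le
    ((Finset.measurable_sum _ fun a _ => measurable_pi_apply a).const_mul κ)
    (measurable_form _).abs

/-- The exceptional set lies in countably many proper subspaces, the kernels of integral forms. -/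
theorem volume_not_generic (π : GenPerm A) :
    (stdOrthonormalBasis ℝ π.lengthSpace).toBasis.addHaar
      {v : π.lengthSpace | ¬ π.Generic fun a => v.1 a} = 0 := by
  have hsub : {v : π.lengthSpace | ¬ π.Generic fun a => v.1 a} ⊆
      ⋃ n : {n : A → ℤ // ∃ u, π.IsBalanced u ∧ ∑ a, (n a : ℝ) * u a ≠ 0},
        (LinearMap.ker (coordForm π fun a => n.1 a) : Set π.lengthSpace) := by
    intro v hv
    simp only [Set.mem_ofPred_eq, GenPerm.Generic, not_forall, not_not] at hv
    obtain ⟨n, hn, h0⟩ := hv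
    exact Set.mem_iUnion.mpr ⟨⟨n, hn⟩, h0⟩
  refine measure_mono_null hsub (measure_iUnion_null fun n => ?_)
  refine Measure.addHaar_submodule _ _ fun htop => ?_
  obtain ⟨u, hu, hne⟩ := n.2
  have : hu.toLengthSpace ∈ LinearMap.ker (coordForm π fun a => n.1 a) := htop ▸ Submodule.mem_top
  exact hne this

theorem rauzyVolume_le_inter_generic (S : Set π.lengthSpace) :
    rauzyVolume π S ≤ rauzyVolume π (S ∩ {v | π.Generic fun a => v.1 a}) := by
  unfold rauzyVolume
  have hsub : {x | ∃ t : ℝ, 0 < t ∧ t ≤ 1 ∧ ∃ v ∈ S, x = t • v} ⊆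
      {x | ∃ t : ℝ, 0 < t ∧ t ≤ 1 ∧ ∃ v ∈ S ∩ {v | π.Generic fun a => v.1 a}, x = t • v} ∪
        {v | ¬ π.Generic fun a => v.1 a} := by
    rintro x ⟨t, h0, h1, v, hv, rfl⟩
    by_cases hg : π.Generic fun a => v.1 a
    · exact Or.inl ⟨t, h0, h1, v, ⟨hv, hg⟩, rfl⟩
    · refine Or.inr fun h => hg fun n hn h2 => h n hn ?_
      have : ∑ a, (n a : ℝ) * (t • v).1 a = t * ∑ a, (n a : ℝ) * v.1 a := by
        rw [Finset.mul_sum]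
        exact Finset.sum_congr rfl fun a _ => by simp; ring
      rw [this, h2, mul_zero]
  refine (measure_mono hsub).trans ((measure_union_le _ _).trans_eq ?_)
  rw [volume_not_generic π, add_zero]

/-- The cone over a part of a simplex `Δ(γ)`. -/
theorem mem_pyramid {γ : List (RauzyArrow A)} {Q : (A → ℝ) → Prop}
    (hQ : ∀ v (t : ℝ), 0 < t → Q v → Q (t • v)) {x : π.lengthSpace} (hx : ∀ a, 0 < x.1 a)
    (hf : RauzyFollows π (fun a => x.1 a) γ) (h0 : 0 < ∑ a, x.1 a) (h1 : ∑ a, x.1 a ≤ 1)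
    (hQx : Q fun a => x.1 a) :
    ∃ t : ℝ, 0 < t ∧ t ≤ 1 ∧ ∃ v ∈ rauzySimplex π γ ∩ {v | Q fun a => v.1 a}, x = t • v := by
  refine ⟨∑ a, x.1 a, h0, h1, (∑ a, x.1 a)⁻¹ • x, ⟨⟨fun a => ?_, ?_, ?_⟩, ?_⟩, ?_⟩
  · exact mul_pos (inv_pos.mpr h0) (hx a)
  · simp [← Finset.mul_sum, h0.ne']
  · exact hf.smul (inv_pos.mpr h0)
  · exact hQ _ _ (inv_pos.mpr h0) hQx
  · rw [smul_smul, mul_inv_cancel₀ h0.ne', one_smul]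

theorem rauzyVolume_le_goodDirection {γ : List (RauzyArrow A)} {v : A → ℝ} (hd : LengthDatum π v)
    (hf : RauzyFollows π v γ) {P M : ℝ} (hP : 0 < P) (hq : ∀ a, weight γ 1 a ≤ P)
    (hM : M = Fintype.card A * (2 * Fintype.card A ^ 2 * 5 ^ (Fintype.card A ^ 2))) :
    rauzyVolume π (rauzySimplex π γ) ≤
      ENNReal.ofReal ((3 ^ Fintype.card A + 1 : ℕ) *
        (1 + (3 ^ Fintype.card A + 1 : ℕ) * M) ^ Fintype.card A) *
      rauzyVolume π (rauzySimplex π γ ∩ {v | GoodDirection (arrowNames γ)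
        (2 * (1 + (3 ^ Fintype.card A + 1 : ℕ) * M) * P)⁻¹ π fun a => v.1 a}) := by
  obtain ⟨U, hU0, hUb, hUf, hUM, hU⟩ := exists_direction hd hf hP hq
  rw [← hM] at hUM
  have hU0' : 0 ≤ ∑ a, U a := Finset.sum_nonneg fun a _ => (hU0 a).le
  have hM0 : 0 ≤ M := hU0'.trans hUM
  set m := 3 ^ Fintype.card A + 1 with hm
  have hρ : 1 ≤ 1 + (m : ℝ) * M := by
    have := mul_nonneg (Nat.cast_nonneg (α := ℝ) m) hM0
    linarith
  set ρ := 1 + (m : ℝ) * M with hρdef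
  have hρ0 : 0 < ρ := by linarith
  have hs : ∀ x : π.lengthSpace, coordForm π 1 x = ∑ a, x.1 a := fun x => by
    simp [coordForm]
  refine measure_le_of_transvections _ (s := coordForm π 1) (U := hUb.toLengthSpace) ?_ ?_ hρ ?_
  · rw [hs]
    exact hU0'
  · exact (Submodule.finrank_le _).trans_eq finrank_euclideanSpace
  · rintro x ⟨t, ht0, ht1, v, ⟨hv0, hv1, hvf⟩, rfl⟩
    set x := t • v with hx
    have hx0 : ∀ a, 0 < x.1 a := fun a => mul_pos ht0 (hv0 a)
    have hxf : RauzyFollows π (fun a => x.1 a) γ := hvf.smul ht0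
    have hxs : ∑ a, x.1 a = t := by
      have : ∑ a, x.1 a = t * ∑ a, v.1 a := by
        rw [Finset.mul_sum]
        rfl
      rw [this, hv1, mul_one]
    obtain ⟨j, hj, hgood⟩ := exists_goodDirection (W := arrowNames γ) hP (v := fun a => x.1 a)
      hU0 hUM hU (by rw [hxs]; exact ht0)
    rw [← hm, ← hρdef] at hgood
    refine ⟨j, hj, ?_⟩
    rw [hs]
    have hcoord : ∀ a, (x + (∑ a, x.1 a) • ((j : ℝ) • hUb.toLengthSpace)).1 a =
        ((fun a => x.1 a) + (∑ a, x.1 a) • ((j : ℝ) • U)) a := fun a => rfl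
    set y := x + (∑ a, x.1 a) • ((j : ℝ) • hUb.toLengthSpace) with hy
    have hyf : RauzyFollows π (fun a => y.1 a) γ := by
      -- The cone of `γ` is given by strict inequalities and may not contain the zero vector, so `j
      -- = 0` is separate.
      rcases Nat.eq_zero_or_pos j with rfl | hj0
      · have : y = x := by simp [hy]
        rw [this]
        exact hxf
      · exact hxf.add ((hUf.smul (Nat.cast_pos.mpr hj0)).smul (hxs ▸ ht0))
    have hy0 : ∀ a, 0 < y.1 a := fun a => by
      rw [hcoord]
      exact add_pos_of_pos_of_nonneg (hx0 a) (mul_nonneg (hxs ▸ ht0.le)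
        (mul_nonneg (Nat.cast_nonneg j) (hU0 a).le))
    have hys : ∑ a, y.1 a = t * (1 + j * ∑ a, U a) := by
      simp only [hcoord, Pi.add_apply, Pi.smul_apply, smul_eq_mul, Finset.sum_add_distrib,
        ← Finset.mul_sum, hxs]
      ring
    have hjM : (j : ℝ) * ∑ a, U a ≤ m * M :=
      mul_le_mul (by exact_mod_cast hj.le) hUM hU0' (Nat.cast_nonneg m)
    have hjU : 0 ≤ (j : ℝ) * ∑ a, U a := mul_nonneg (Nat.cast_nonneg j) hU0'
    have hyz : ∑ a, (ρ⁻¹ • y).1 a = ρ⁻¹ * ∑ a, y.1 a := by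
      rw [Finset.mul_sum]
      rfl
    refine mem_pyramid (Q := GoodDirection (arrowNames γ) (2 * ρ * P)⁻¹ π)
      (fun v t ht h => h.smul ht) (fun a => mul_pos (inv_pos.mpr hρ0) (hy0 a))
      (hyf.smul (inv_pos.mpr hρ0)) ?_ ?_ (GoodDirection.smul hgood (inv_pos.mpr hρ0))
    · rw [hyz, hys]
      have : 0 < 1 + (j : ℝ) * ∑ a, U a := by linarith
      positivity
    · rw [hyz, hys, inv_mul_le_iff₀ hρ0, mul_one]
      calc t * (1 + j * ∑ a, U a) ≤ 1 * (1 + m * M) :=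
            mul_le_mul ht1 (by linarith) (by linarith) zero_le_one
        _ = ρ := one_mul _

end Volumes

/-! ### Choice of constants and conclusion. -/

section Assembly

variable {A : Type*}

theorem exists_large_weight {W : Finset A} (hW : W.Nonempty) {q : A → ℝ} {C : ℝ} (hC : 0 < C) :
    ∃ a ∈ W, (C * ∑ b ∈ W, q b) / (C * W.card) ≤ q a := by
  obtain ⟨a, ha, hmax⟩ := Finset.exists_max_image W q hW
  refine ⟨a, ha, ?_⟩
  have hc : (0 : ℝ) < W.card := by exact_mod_cast hW.card_pos
  rw [mul_div_mul_left _ _ hC.ne', div_le_iff₀ hc]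
  calc ∑ b ∈ W, q b ≤ ∑ _b ∈ W, q a := Finset.sum_le_sum hmax
    _ = q a * W.card := by rw [Finset.sum_const, nsmul_eq_mul, mul_comm]

variable [DecidableEq A] [Fintype A]

theorem GoodDirection.separated {W : Finset A} {κ : ℝ} {π : GenPerm A} {v : A → ℝ}
    (h : GoodDirection W κ π v) (hv : ∑ a, v a = 1) : Separated W κ π v := by
  intro σ h1 h2 h3 u hu
  by_contra hne
  have := h σ h1 h2 ⟨u, hu, hne⟩
  rw [hv, mul_one] at this
  linarith

/-- A definite proportion of the data that follow `γ` leave the set of names of `γ` within a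
bounded number of segments. -/
theorem exists_subset_exitsWithin {d k : ℕ} (hcd : Fintype.card A = d) {M ρ : ℝ}
    (hM : M = d * (2 * d ^ 2 * 5 ^ (d ^ 2))) (hρ : ρ = 1 + (3 ^ d + 1 : ℕ) * M)
    (hk : 2 * ρ * ((2 * d + 2 : ℕ) * d) < 2 ^ k) {π : GenPerm A} (hπ : π.Irreducible)
    {γ : List (RauzyArrow A)} (hW : arrowNames γ ≠ Finset.univ) (hcard : 1 < (arrowNames γ).card) :
    ∃ Δ' : Set π.lengthSpace, Δ' ⊆ rauzySimplex π γ ∧ MeasurableSet Δ' ∧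
      rauzyVolume π (rauzySimplex π γ) ≤
        ENNReal.ofReal ((3 ^ d + 1 : ℕ) * ρ ^ d) * rauzyVolume π Δ' ∧
      ∀ v ∈ Δ', ExitsWithin (2 * (4 * d + 2 * k + 1) + 1) π (fun a => v.1 a) γ := by
  have hM0 : 0 ≤ M := by rw [hM]; positivity
  have hρ1 : 1 ≤ ρ := by
    rw [hρ]
    have := mul_nonneg (Nat.cast_nonneg (α := ℝ) (3 ^ d + 1)) hM0
    linarith
  have hgm : MeasurableSet {v : π.lengthSpace | π.Generic fun a => v.1 a} :=
    measurable_coord π measurableSet_generic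
  -- A point of the simplex is needed in `exists_direction`, to have a positive balanced vector at
  -- the end of `γ`.
  rcases Set.eq_empty_or_nonempty (rauzySimplex π γ) with he | ⟨v₀, h0⟩
  · refine ⟨∅, Set.empty_subset _, MeasurableSet.empty, ?_, by simp⟩
    rw [he]
    simp [rauzyVolume]
  have hdatum : ∀ v ∈ rauzySimplex π γ, LengthDatum π fun a => v.1 a := fun v hv =>
    ⟨hπ.suspendable, hv.1, lengthSpace_isBalanced v⟩
  obtain ⟨γ, e, rfl⟩ := (List.eq_nil_or_concat' γ).resolve_left (by rintro rfl; simp at hcard)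
  have hpath := h0.2.2.isRauzyPath
  have hq0 : ∀ a : A, (0 : ℝ) ≤ (1 : A → ℝ) a := fun _ => zero_le_one
  rcases (pathBound_of_path hcard hpath subset_rfl).le
    (zero_le_one.trans (le_weight hq0 e.winner)) with hb | hb
  · refine ⟨_, Set.inter_subset_left, (measurableSet_rauzySimplex _).inter hgm, ?_, ?_⟩
    · refine (rauzyVolume_le_inter_generic _).trans (le_mul_of_one_le_left zero_le ?_)
      rw [← ENNReal.ofReal_one]
      refine ENNReal.ofReal_le_ofReal (one_le_mul_of_one_le_of_one_le ?_ (one_le_pow₀ hρ1))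
      exact_mod_cast Nat.le_add_left 1 _
    · rintro v ⟨hv, hg⟩
      obtain ⟨δ, e', h1, h2, h3⟩ :=
        exitsWithin_of_blocked (hdatum v hv) hg hv.2.2 hW hcard hb
      exact ⟨δ, e', h1, h2, h3.mono (by omega)⟩
  · set W := arrowNames (γ ++ [e])
    set q := weight (γ ++ [e]) 1 with hq
    set C : ℝ := ((2 * Fintype.card A + 2 : ℕ) : ℝ) with hC
    have hC0 : 0 < C := by rw [hC]; positivity
    have hWne : W.Nonempty := Finset.card_pos.mp (by omega)
    have hq1 : ∀ a, 1 ≤ q a := fun a => le_weight hq0 a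
    have hS : 0 < ∑ a ∈ W, q a := Finset.sum_pos (fun a _ => by linarith [hq1 a]) hWne
    have hP : 0 < C * ∑ a ∈ W, q a := mul_pos hC0 hS
    have hvol := rauzyVolume_le_goodDirection (hdatum v₀ h0) h0.2.2 hP hb rfl
    rw [hcd, ← hM, ← hρ] at hvol
    refine ⟨_, Set.inter_subset_left.trans Set.inter_subset_left,
      ((measurableSet_rauzySimplex _).inter
        (measurable_coord π (measurableSet_goodDirection _ _))).inter hgm,
      hvol.trans (mul_le_mul_right (rauzyVolume_le_inter_generic _) _), ?_⟩
    rintro v ⟨⟨hv, hgood⟩, hg⟩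
    have hWc : (0 : ℝ) < W.card := by exact_mod_cast hWne.card_pos
    have hWd : (W.card : ℝ) ≤ d := by exact_mod_cast hcd ▸ W.card_le_univ
    have := exitsWithin_of_separated (k := k) (hdatum v hv) hg hv.2.1 hv.2.2 hW hcard
      (hgood.separated hv.2.1) (exists_large_weight (q := q) hWne hC0)
      (div_pos hP (mul_pos hC0 hWc)) ?_
    · rwa [hcd] at this
    -- Here `θ` is the mean weight on `W` and `κ` the inverse of `2 * ρ * C` times the total weight;
    -- the weights cancel in `θ * κ`, so `k` depends only on `d`.
    · have hlt : 2 * ρ * (C * W.card) < 2 ^ k := by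
        refine lt_of_le_of_lt ?_ hk
        rw [hC, hcd]
        gcongr
      have h6 : (2 : ℝ) ^ k * (C * (∑ a ∈ W, q a) / (C * W.card)) * (2 * ρ * (C * ∑ a ∈ W, q a))⁻¹ =
          2 ^ k / (2 * ρ * (C * W.card)) := by
        field_simp
      rw [h6, one_lt_div (by positivity)]
      exact hlt

end Assembly

theorem mainTheorem3 (d : ℕ) :
    ∃ (l : ℕ) (η : ℝ), 0 < η ∧
      ∀ (A : Type*) [Fintype A] [DecidableEq A], Fintype.card A = d →
      ∀ (π : GenPerm A), π.Irreducible →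
      ∀ (γ : List (RauzyArrow A)), IsRauzyPath π γ →
      ∀ (A' : Finset A) (D : ℕ), A' = arrowNames γ → A' ≠ Finset.univ → D = A'.card → 1 < D →
      ∃ Δ' : Set π.lengthSpace, Δ' ⊆ rauzySimplex π γ ∧ MeasurableSet Δ' ∧
        ENNReal.ofReal η * rauzyVolume π (rauzySimplex π γ) ≤ rauzyVolume π Δ' ∧
        -- `N = γ.length`; `e` is the arrow of `T = (π, v)` with index `M = N + δ.length + 1`, and
        -- `γ.drop (γ.length - 1) ++ δ` is the list of its arrows with index `n`, `N ≤ n < M`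
        ∀ v ∈ Δ', ∃ (δ : List (RauzyArrow A)) (e : RauzyArrow A),
          RauzyFollows π (fun a => v.1 a) (γ ++ δ ++ [e]) ∧
          e.winner ∉ A' ∧
          CoveredBySegments l (D - 1) (γ.drop (γ.length - 1) ++ δ) := by

  obtain ⟨k, hk⟩ := pow_unbounded_of_one_lt
    (2 * (1 + (3 ^ d + 1 : ℕ) * ((d : ℝ) * (2 * d ^ 2 * 5 ^ (d ^ 2)))) * ((2 * d + 2 : ℕ) * d))
    (one_lt_two (α := ℝ))
  have hρ : (0 : ℝ) < (3 ^ d + 1 : ℕ) *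
      (1 + (3 ^ d + 1 : ℕ) * ((d : ℝ) * (2 * d ^ 2 * 5 ^ (d ^ 2)))) ^ d := by positivity
  -- Two segments for each of `4 * d + 2 * k + 1` blocks, and one for the last arrow of `γ`.
  refine ⟨2 * (4 * d + 2 * k + 1) + 1, _, inv_pos.mpr hρ, ?_⟩
  rintro A _ _ hcd π hπ γ - A' D rfl hW rfl hcard
  obtain ⟨Δ', h1, h2, h3, h4⟩ := exists_subset_exitsWithin hcd rfl rfl hk hπ hW hcard
  refine ⟨Δ', h1, h2, ?_, h4⟩
  rw [ENNReal.ofReal_inv_of_pos hρ]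
  exact ENNReal.inv_mul_le_iff (by simpa using hρ) ENNReal.ofReal_ne_top |>.mpr h3
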